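/- Let $\mathfrak H$ be the upper half plane, $q=e^{2\pi i z}$, $\mathbb L=\log|q|=-2\pi\,\mathrm{Im}(z)$. For $k\in\mathbb Z$ let $M^!_k$ be the space of weakly holomorphic modular forms of weight $k$ for $\Gamma=\mathrm{SL}_2(\mathbb Z)$, i.e. holomorphic functions on $\mathfrak H$ that are modular of weight $k$ and have a Fourier expansion $\sum_{j\ge -N}a_jq^j$. For $r,s\in\mathbb Z$ let $\mathcal M^!_{r,s}$ be the space of real analytic $F:\mathfrak H\to\mathbb C$ with $F(\gamma z)=(cz+d)^r(c\bar z+d)^sF(z)$ for all $\gamma=\begin{pmatrix}a&b\\c&d\end{pmatrix}\in\Gamma$, which admit an expansion $F=\sum_{|k|\le M}\mathbb L^k\sum_{i,j\ge -N}a^{(k)}_{i,j}q^i\bar q^j$. On functions of weights $(r,s)$ put $$\partial=(z-\bar z)\frac{\partial}{\partial z}+r,\qquad \overline\partial=(\bar z-z)\frac{\partial}{\partial\bar z}+s$$ (with values in weights $(r+1,s-1)$ and $(r-1,s+1)$; powers of $\partial,\overline\partial$ are taken accordingly), and, for $m\ge1$, $$T_mF(z)=\sum_{\alpha\in\Gamma\backslash\{\alpha\in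 M_2(\mathbb Z):\det\alpha=m\}}\frac{m^{r+s-1}}{(c_\alpha z+d_\alpha)^r(c_\alpha\bar z+d_\alpha)^s}F(\alpha z).$$ Let $D=\frac1{2\pi i}\frac{d}{dz}$ and $n\ge0$. A form $f\in M^!_{n+2}$ is called a weak Hecke eigenform with eigenvalues $(\lambda_m)_{m\ge1}$ if $(T_m-\lambda_m)f\in D^{n+1}M^!_{-n}$ for all $m\ge1$. Let $f,g\in M^!_{n+2}$ and let $X_{r,s}\in\mathcal M^!_{r,s}$, for $r,s\ge0$ with $r+s=n$, satisfy $$\partial X_{n,0}=\mathbb L f,\quad \partial X_{r,s}=(r+1)X_{r+1,s-1}\ (s\ge1),\quad \overline\partial X_{r,s}=(s+1)X_{r-1,s+1}\ (r\ge1),\quad \overline\partial X_{0,n}=\mathbb L\,\overline g .$$ Let $(\lambda_m)_{m\ge1}$ be complex numbers. Then $f$ is a weak Hecke eigenform with eigenvalues $\lambda_m$ if and only if $g$ is a weak Hecke eigenform with eigenvalues $\overline{\lambda_m}$; in particular, if all $\lambda_m$ are real, then $f$ is a weak Hecke eigenform with eigenvalues $\lambda_m$ if and only if $g$ is a weak Hecke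 eigenform with the same eigenvalues $\lambda_m$. In this case, for every $m\ge1$ there are $\psi_m,\phi_m\in M^!_{-n}$ with $$(T_m-\lambda_m)f=\frac1{n!}\mathbb L^{-n-1}\partial^{n+1}\psi_m,\qquad (T_m-\overline{\lambda_m})g=\frac1{n!}\mathbb L^{-n-1}\partial^{n+1}\phi_m,$$ and, for all $r,s\ge0$ with $r+s=n$, $$\Big(T_m-\frac{\lambda_m}m\Big)X_{r,s}=\frac1m\,\mathbb L^{-n}\Big(\frac{\partial^r}{r!}\psi_m+\frac{\overline\partial^s}{s!}\overline{\phi_m}\Big).$$ -/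

import Mathlib

open scoped MatrixGroups ComplexConjugate UpperHalfPlane Manifold

noncomputable section

namespace NonHolModular

open UpperHalfPlane

/-- `q = exp (2 π i z)`. -/
def qParam (z : ℍ) : ℂ := Complex.exp (2 * Real.pi * Complex.I * (z : ℂ))

/-- `𝕃 = log |q| = -2 π Im z`, as a complex number. -/
def LL (z : ℍ) : ℂ := ((-2 * Real.pi * z.im : ℝ) : ℂ)

/-- Pointwise complex conjugate of a function on the upper half plane. -/
def conjFun (f : ℍ → ℂ) : ℍ → ℂ := fun z => conj (f z)

/-- Modularity of weights `(r, s)` for `SL₂(ℤ)`: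
`f (γ z) = (c z + d) ^ r (c z̄ + d) ^ s f z`. -/
def IsModular (r s : ℤ) (f : ℍ → ℂ) : Prop :=
  ∀ (γ : SL(2, ℤ)) (z : ℍ),
    f (γ • z) = ((γ 1 0 : ℂ) * z + (γ 1 1 : ℂ)) ^ r *
      ((γ 1 0 : ℂ) * conj (z : ℂ) + (γ 1 1 : ℂ)) ^ s * f z

/-- The space `M^!_k` of weakly holomorphic modular forms of weight `k` and level one:
holomorphic on the upper half plane, modular of weight `k`, with a convergent Fourier expansion
`∑_{j ≥ -N} a_j q ^ j`. -/
structure IsWeaklyHolomorphic (k : ℤ) (f : ℍ → ℂ) : Prop where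
  holo : MDifferentiable 𝓘(ℂ) 𝓘(ℂ) f
  modular : IsModular k 0 f
  expansion : ∃ (N : ℕ) (a : ℕ → ℂ), ∀ z : ℍ,
    HasSum (fun j : ℕ => a j * qParam z ^ ((j : ℤ) - N)) (f z)

/-- The space `𝓜^!_{r,s}`: real analytic functions on the upper half plane, modular of weights
`(r, s)`, with an expansion `∑_{|k| ≤ M} 𝕃 ^ k ∑_{i, j ≥ -N} a^{(k)}_{i,j} q ^ i q̄ ^ j`,
where each of the double series converges (absolutely) on the upper half plane. -/
structure IsRealAnalyticModular (r s : ℤ) (f : ℍ → ℂ) : Prop where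
  analytic : AnalyticOnNhd ℝ (f ∘ ofComplex) {z : ℂ | 0 < z.im}
  modular : IsModular r s f
  expansion : ∃ (M N : ℕ) (a : ℤ → ℕ × ℕ → ℂ) (F : ℤ → ℍ → ℂ),
    (∀ k ∈ Finset.Icc (-(M : ℤ)) M, ∀ z : ℍ,
      HasSum (fun p : ℕ × ℕ =>
        a k p * qParam z ^ ((p.1 : ℤ) - N) * conj (qParam z) ^ ((p.2 : ℤ) - N)) (F k z)) ∧
    ∀ z : ℍ, f z = ∑ k ∈ Finset.Icc (-(M : ℤ)) M, LL z ^ k * F k z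

/-- `∂/∂z = (∂/∂x - i ∂/∂y) / 2`. -/
def wirtinger (f : ℍ → ℂ) (z : ℍ) : ℂ :=
  (fderiv ℝ (f ∘ ofComplex) (z : ℂ) 1
    - Complex.I * fderiv ℝ (f ∘ ofComplex) (z : ℂ) Complex.I) / 2

/-- `∂/∂z̄ = (∂/∂x + i ∂/∂y) / 2`. -/
def wirtingerBar (f : ℍ → ℂ) (z : ℍ) : ℂ :=
  (fderiv ℝ (f ∘ ofComplex) (z : ℂ) 1
    + Complex.I * fderiv ℝ (f ∘ ofComplex) (z : ℂ) Complex.I) / 2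

/-- `∂_r = (z - z̄) ∂/∂z + r`. -/
def del (r : ℤ) (f : ℍ → ℂ) (z : ℍ) : ℂ :=
  ((z : ℂ) - conj (z : ℂ)) * wirtinger f z + r * f z

/-- `∂̄_s = (z̄ - z) ∂/∂z̄ + s`. -/
def delBar (s : ℤ) (f : ℍ → ℂ) (z : ℍ) : ℂ :=
  (conj (z : ℂ) - (z : ℂ)) * wirtingerBar f z + s * f z

/-- The `k`-th power of the bigraded operator `∂` on functions of weights `(r, *)`,
i.e. `∂_{r+k-1} ⋯ ∂_{r+1} ∂_r`. -/
def delPow (r : ℤ) : ℕ → (ℍ → ℂ) → ℍ → ℂ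
  | 0, f => f
  | k + 1, f => del (r + k) (delPow r k f)

/-- The `k`-th power of the bigraded operator `∂̄` on functions of weights `(*, s)`,
i.e. `∂̄_{s+k-1} ⋯ ∂̄_{s+1} ∂̄_s`. -/
def delBarPow (s : ℤ) : ℕ → (ℍ → ℂ) → ℍ → ℂ
  | 0, f => f
  | k + 1, f => delBar (s + k) (delBarPow s k f)

/-- The summand
`m ^ (r + s - 1) (c z + d) ^ (-r) (c z̄ + d) ^ (-s) f (α z)`, `α = (a b; c d)` of determinant `m`,
of the Hecke operator. For `m > 0` the number `(a z + b) / (c z + d)` lies in the upper half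
plane, and for `f` modular of weights `(r, s)` the value depends only on the coset `SL₂(ℤ) α`. -/
def heckeTerm (m : ℕ) (r s : ℤ) (f : ℍ → ℂ) (α : Matrix (Fin 2) (Fin 2) ℤ) (z : ℍ) : ℂ :=
  (m : ℂ) ^ (r + s - 1) /
      (((α 1 0 : ℂ) * z + (α 1 1 : ℂ)) ^ r * ((α 1 0 : ℂ) * conj (z : ℂ) + (α 1 1 : ℂ)) ^ s) *
    f (ofComplex (((α 0 0 : ℂ) * z + (α 0 1 : ℂ)) / ((α 1 0 : ℂ) * z + (α 1 1 : ℂ))))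

/-- The Hecke operator `T_m` on functions modular of weights `(r, s)`: the (finite) sum of the
`heckeTerm`s over the cosets `SL₂(ℤ) \ {α ∈ M₂(ℤ) : det α = m}`. -/
def hecke (m : ℕ) (r s : ℤ) (f : ℍ → ℂ) (z : ℍ) : ℂ :=
  ∑ᶠ c : MulAction.orbitRel.Quotient SL(2, ℤ) (FixedDetMatrix (Fin 2) ℤ (m : ℤ)),
    heckeTerm m r s f (Quotient.out c).1 z

/-- `f ∈ M^!_{n+2}` is a weak Hecke eigenform with eigenvalues `lam m`, `m ≥ 1`:
`T_m f ≡ lam m • f` modulo `D ^ (n+1) M^!_{-n}`, where `D = (2 π i)⁻¹ d/dz`. -/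
def IsWeakHeckeEigenform (n : ℕ) (f : ℍ → ℂ) (lam : ℕ → ℂ) : Prop :=
  IsWeaklyHolomorphic (n + 2) f ∧
  ∀ m : ℕ, 1 ≤ m → ∃ ξ : ℍ → ℂ, IsWeaklyHolomorphic (-n) ξ ∧
    ∀ z : ℍ, hecke m (n + 2) 0 f z - lam m * f z =
      (Derivative.normalizedDerivOfComplex^[n + 1] ξ) z

/-- `X_{r,s}` (`r + s = n`) is the family attached to a modular primitive `X_{n,0}` of `𝕃 f`,
and `g` is the weakly holomorphic form at its other end. -/
structure IsPrimitiveFamily (n : ℕ) (f g : ℍ → ℂ) (X : ℕ → ℕ → ℍ → ℂ) : Prop where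
  f_mem : IsWeaklyHolomorphic (n + 2) f
  g_mem : IsWeaklyHolomorphic (n + 2) g
  X_mem : ∀ r s : ℕ, r + s = n → IsRealAnalyticModular r s (X r s)
  del_top : ∀ z, del n (X n 0) z = LL z * f z
  del_eq : ∀ r s : ℕ, r + (s + 1) = n →
    ∀ z, del r (X r (s + 1)) z = (r + 1) * X (r + 1) s z
  delBar_eq : ∀ r s : ℕ, (r + 1) + s = n →
    ∀ z, delBar s (X (r + 1) s) z = (s + 1) * X r (s + 1) z
  delBar_bot : ∀ z, delBar n (X 0 n) z = LL z * conj (g z)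

end NonHolModular

end

noncomputable section

namespace NonHolModular

open UpperHalfPlane

open scoped ContDiff Topology

/-! The operators `T_m` commute with `∂` and `∂̄` (`del_hecke`, `delBar_hecke`), while `T_m (𝕃 F) =
m⁻¹ 𝕃 T_m F` (`hecke_LL_mul`). Hence `Y_{r,s} = m T_m X_{r,s} - λ X_{r,s}` is again a ladder, with
ends `𝕃 (T_m - λ) f` and the conjugate of `𝕃 (T_m - λ̄) g`.

By Bol's identity (`delPow_bol`), `f` is a weak eigenform exactly when `(T_m - λ) f` is `𝕃^{-n-1}
∂^{n+1} ψ / n!` with `ψ ∈ M^!_{-n}`. Then `E_r = 𝕃^{-n} ∂^r ψ / r!` satisfies the same `∂̄`-ladder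
relations (an `sl₂` computation, `delBar_delPow_succ`), has the same upper end as `Y`, and is killed
by `∂̄` at its lower end. So `Z = Y - E` satisfies `∂ Z_{n,0} = 0`, which makes `𝕃^n Z_{n,0}`
antiholomorphic: it is the conjugate of some `φ` of weight `-n`. Descending by `∂̄` gives `Z_{r,s} =
𝕃^{-n} ∂̄^s φ̄ / s!`, and the lower end expresses `(T_m - λ̄) g` through `φ` (`exists_companion`).
The converse is the same statement for the conjugate family (`swap`).

It remains that `φ` has a finite pole at the cusp. Fourier expansions are traded for exponential
growth in `Im z`, which survives every operation used; for holomorphic modular functions it gives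
the expansion back (`isWeaklyHolomorphic_of_hasExpGrowth`). -/

/-! ### Wirtinger calculus on the upper half plane -/

/-- The real-linear map `v ↦ A v + B v̄`. -/
def wirtingerCLM (A B : ℂ) : ℂ →L[ℝ] ℂ :=
  A • ContinuousLinearMap.id ℝ ℂ + B • (Complex.conjCLE : ℂ →L[ℝ] ℂ)

@[simp]
lemma wirtingerCLM_apply (A B v : ℂ) : wirtingerCLM A B v = A * v + B * conj v := by
  simp [wirtingerCLM]

/-- `f` is real differentiable at `z` with `∂f/∂z = A` and `∂f/∂z̄ = B`. -/
def HasWirtingerAt (f : ℍ → ℂ) (A B : ℂ) (z : ℍ) : Prop :=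
  HasFDerivAt (f ∘ ofComplex) (wirtingerCLM A B) (z : ℂ)

lemma HasWirtingerAt.wirtinger_eq {f : ℍ → ℂ} {A B : ℂ} {z : ℍ} (h : HasWirtingerAt f A B z) :
    wirtinger f z = A := by
  have h' : fderiv ℝ (f ∘ ofComplex) (z : ℂ) = wirtingerCLM A B := HasFDerivAt.fderiv h
  simp only [wirtinger, h', wirtingerCLM_apply, map_one, Complex.conj_I]
  linear_combination (-(1 / 2) * A + (1 / 2) * B) * Complex.I_mul_I

lemma HasWirtingerAt.wirtingerBar_eq {f : ℍ → ℂ} {A B : ℂ} {z : ℍ} (h : HasWirtingerAt f A B z) :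
    wirtingerBar f z = B := by
  have h' : fderiv ℝ (f ∘ ofComplex) (z : ℂ) = wirtingerCLM A B := HasFDerivAt.fderiv h
  simp only [wirtingerBar, h', wirtingerCLM_apply, map_one, Complex.conj_I]
  linear_combination ((1 / 2) * A - (1 / 2) * B) * Complex.I_mul_I

lemma hasWirtingerAt_of_differentiableAt {f : ℍ → ℂ} {z : ℍ}
    (h : DifferentiableAt ℝ (f ∘ ofComplex) (z : ℂ)) :
    HasWirtingerAt f (wirtinger f z) (wirtingerBar f z) z := by
  have h' := h.hasFDerivAt
  unfold HasWirtingerAt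
  convert h' using 1
  ext v
  set T := fderiv ℝ (f ∘ ofComplex) (z : ℂ) with hT
  have hv : T v = v.re * T 1 + v.im * T Complex.I := by
    conv_lhs => rw [show v = v.re • (1 : ℂ) + v.im • Complex.I by
      simp [Complex.re_add_im]]
    rw [map_add, map_smul, map_smul]
    simp
  rw [hv, wirtingerCLM_apply, wirtinger, wirtingerBar, ← hT]
  have h1 : v = v.re + v.im * Complex.I := (Complex.re_add_im v).symm
  have h2 : conj v = v.re - v.im * Complex.I := by
    apply Complex.ext <;> simp
  rw [h2]
  conv_lhs => rw [h1]
  simp only [Complex.add_re, Complex.ofReal_re, Complex.mul_re, Complex.I_re, Complex.ofReal_im,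
    Complex.I_im, Complex.add_im, Complex.mul_im]
  push_cast
  linear_combination (-(v.im : ℂ) * T Complex.I) * Complex.I_mul_I

namespace HasWirtingerAt

variable {f g : ℍ → ℂ} {A B A' B' : ℂ} {z : ℍ}

lemma congr_coeff (h : HasWirtingerAt f A B z) (hA : A = A') (hB : B = B') :
    HasWirtingerAt f A' B' z := hA ▸ hB ▸ h

lemma add (hf : HasWirtingerAt f A B z) (hg : HasWirtingerAt g A' B' z) :
    HasWirtingerAt (fun w => f w + g w) (A + A') (B + B') z := by
  unfold HasWirtingerAt at *
  refine (HasFDerivAt.add hf hg).congr_fderiv (ContinuousLinearMap.ext fun v => ?_)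
  simp; ring

lemma sub (hf : HasWirtingerAt f A B z) (hg : HasWirtingerAt g A' B' z) :
    HasWirtingerAt (fun w => f w - g w) (A - A') (B - B') z := by
  unfold HasWirtingerAt at *
  refine (HasFDerivAt.sub hf hg).congr_fderiv (ContinuousLinearMap.ext fun v => ?_)
  simp; ring

lemma mul (hf : HasWirtingerAt f A B z) (hg : HasWirtingerAt g A' B' z) :
    HasWirtingerAt (fun w => f w * g w) (f z * A' + A * g z) (f z * B' + B * g z) z := by
  unfold HasWirtingerAt at *
  refine (HasFDerivAt.mul hf hg).congr_fderiv (ContinuousLinearMap.ext fun v => ?_)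
  simp; ring

lemma const (c : ℂ) : HasWirtingerAt (fun _ => c) 0 0 z := by
  unfold HasWirtingerAt
  refine (hasFDerivAt_const c (z : ℂ)).congr_fderiv (ContinuousLinearMap.ext fun v => ?_)
  simp

lemma const_mul (c : ℂ) (hf : HasWirtingerAt f A B z) :
    HasWirtingerAt (fun w => c * f w) (c * A) (c * B) z :=
  ((const c).mul hf).congr_coeff (by simp) (by simp)

lemma conjFun (hf : HasWirtingerAt f A B z) :
    HasWirtingerAt (NonHolModular.conjFun f) (starRingEnd ℂ B) (starRingEnd ℂ A) z := by
  unfold HasWirtingerAt at *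
  refine ((Complex.conjCLE : ℂ →L[ℝ] ℂ).hasFDerivAt.comp (z : ℂ) hf).congr_fderiv
    (ContinuousLinearMap.ext fun v => ?_)
  simp; ring

lemma sum {ι : Type*} (s : Finset ι) {F : ι → ℍ → ℂ} {a b : ι → ℂ}
    (h : ∀ i ∈ s, HasWirtingerAt (F i) (a i) (b i) z) :
    HasWirtingerAt (fun w => ∑ i ∈ s, F i w) (∑ i ∈ s, a i) (∑ i ∈ s, b i) z := by
  classical
  induction s using Finset.induction_on with
  | empty => simpa using const 0
  | insert i s hi ih =>
    simp only [Finset.sum_insert hi]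
    exact (h i (Finset.mem_insert_self i s)).add
      (ih fun j hj => h j (Finset.mem_insert_of_mem hj))

lemma of_hasDerivAt {c : ℂ} (h : HasDerivAt (f ∘ ofComplex) c (z : ℂ)) :
    HasWirtingerAt f c 0 z := by
  unfold HasWirtingerAt
  refine (h.hasFDerivAt.restrictScalars ℝ).congr_fderiv (ContinuousLinearMap.ext fun v => ?_)
  simp [mul_comm]

/-- Post-composition with a holomorphic function. -/
lemma scomp {φ : ℂ → ℂ} {c : ℂ} (hφ : HasDerivAt φ c (f z)) (hf : HasWirtingerAt f A B z) :
    HasWirtingerAt (fun w => φ (f w)) (c * A) (c * B) z := by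
  unfold HasWirtingerAt at *
  have h1 : HasDerivAt φ c ((f ∘ ofComplex) (z : ℂ)) := by simpa using hφ
  refine ((h1.hasFDerivAt.restrictScalars ℝ).comp (z : ℂ) hf).congr_fderiv
    (ContinuousLinearMap.ext fun v => ?_)
  simp; ring

lemma zpow (hf : HasWirtingerAt f A B z) (h0 : f z ≠ 0) (k : ℤ) :
    HasWirtingerAt (fun w => f w ^ k) (k * f z ^ (k - 1) * A) (k * f z ^ (k - 1) * B) z :=
  scomp (φ := fun w => w ^ k) (hasDerivAt_zpow k (f z) (Or.inl h0)) hf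

/-- Pre-composition with a holomorphic self-map of the upper half plane. -/
lemma comp {α : ℍ → ℍ} {c : ℂ} (hf : HasWirtingerAt f A B (α z))
    (hα : HasDerivAt ((fun w => (α w : ℂ)) ∘ ofComplex) c (z : ℂ)) :
    HasWirtingerAt (fun w => f (α w)) (A * c) (B * starRingEnd ℂ c) z := by
  unfold HasWirtingerAt at *
  have h1 : HasFDerivAt (f ∘ ofComplex) (wirtingerCLM A B)
      (((fun w => (α w : ℂ)) ∘ ofComplex) (z : ℂ)) := by simpa using hf
  have h2 := h1.comp (z : ℂ) (hα.hasFDerivAt.restrictScalars ℝ)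
  have h3 : (f ∘ ofComplex) ∘ (fun w => (α w : ℂ)) ∘ ofComplex =
      (fun w => f (α w)) ∘ ofComplex := by
    funext w; simp
  rw [h3] at h2
  refine h2.congr_fderiv (ContinuousLinearMap.ext fun v => ?_)
  simp; ring

lemma coe : HasWirtingerAt (fun w => (w : ℂ)) 1 0 z := by
  apply of_hasDerivAt
  exact (hasDerivAt_id (z : ℂ)).congr_of_eventuallyEq (eventuallyEq_coe_comp_ofComplex z.im_pos)

lemma coe_conj : HasWirtingerAt (fun w => starRingEnd ℂ (w : ℂ)) 0 1 z := by
  simpa using! HasWirtingerAt.conjFun (coe (z := z))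

end HasWirtingerAt

/-- Real-smooth functions on the upper half plane. -/
def IsSmooth (f : ℍ → ℂ) : Prop :=
  ContDiffOn ℝ ∞ (f ∘ ofComplex) {z : ℂ | 0 < z.im}

namespace IsSmooth

variable {f g : ℍ → ℂ}

lemma hasWirtingerAt (hf : IsSmooth f) (z : ℍ) :
    HasWirtingerAt f (wirtinger f z) (wirtingerBar f z) z :=
  hasWirtingerAt_of_differentiableAt
    ((hf.differentiableOn (by simp)).differentiableAt
      (isOpen_upperHalfPlaneSet.mem_nhds z.im_pos))

lemma add (hf : IsSmooth f) (hg : IsSmooth g) : IsSmooth (fun z => f z + g z) :=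
  ContDiffOn.add hf hg

lemma sub (hf : IsSmooth f) (hg : IsSmooth g) : IsSmooth (fun z => f z - g z) :=
  ContDiffOn.sub hf hg

lemma mul (hf : IsSmooth f) (hg : IsSmooth g) : IsSmooth (fun z => f z * g z) :=
  ContDiffOn.mul hf hg

lemma const (c : ℂ) : IsSmooth (fun _ => c) := contDiffOn_const

lemma const_mul (c : ℂ) (hf : IsSmooth f) : IsSmooth (fun z => c * f z) := (const c).mul hf

lemma conjFun (hf : IsSmooth f) : IsSmooth (NonHolModular.conjFun f) :=
  (Complex.conjCLE : ℂ →L[ℝ] ℂ).contDiff.comp_contDiffOn hf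

lemma sum {ι : Type*} (s : Finset ι) {F : ι → ℍ → ℂ} (h : ∀ i ∈ s, IsSmooth (F i)) :
    IsSmooth (fun z => ∑ i ∈ s, F i z) :=
  ContDiffOn.sum (f := fun i => F i ∘ ofComplex) h

lemma of_mdifferentiable (hf : MDifferentiable 𝓘(ℂ) 𝓘(ℂ) f) : IsSmooth f := by
  have h := UpperHalfPlane.mdifferentiable_iff.mp hf
  have h' : ContDiffOn ℂ ∞ (f ∘ ofComplex) {z : ℂ | 0 < z.im} :=
    h.contDiffOn isOpen_upperHalfPlaneSet
  exact h'.restrict_scalars ℝ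

lemma coe : IsSmooth (fun z => (z : ℂ)) := of_mdifferentiable mdifferentiable_coe

lemma comp {α : ℍ → ℍ} (hf : IsSmooth f) (hα : IsSmooth fun z => (α z : ℂ)) :
    IsSmooth (fun z => f (α z)) := by
  have h := ContDiffOn.comp hf hα (fun z _ => (α (ofComplex z)).im_pos)
  refine h.congr fun z _ => ?_
  simp

lemma zpow (hf : IsSmooth f) (h0 : ∀ z, f z ≠ 0) (k : ℤ) : IsSmooth (fun z => f z ^ k) := by
  have h : ∀ m : ℕ, IsSmooth (fun z => f z ^ m) := fun m => ContDiffOn.pow hf m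
  cases k with
  | ofNat m => simpa using h m
  | negSucc m =>
    simp only [zpow_negSucc]
    exact ContDiffOn.inv (h (m + 1)) fun z _ => pow_ne_zero _ (h0 _)

lemma fderiv_apply (hf : IsSmooth f) (v : ℂ) :
    IsSmooth (fun z => fderiv ℝ (f ∘ ofComplex) (z : ℂ) v) := by
  have h : ContDiffOn ℝ ∞ (fun z => fderiv ℝ (f ∘ ofComplex) z v) {z : ℂ | 0 < z.im} :=
    (hf.fderiv_of_isOpen isOpen_upperHalfPlaneSet (by simp)).clm_apply contDiffOn_const
  refine h.congr fun z hz => ?_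
  simp [ofComplex_apply_of_im_pos hz]

lemma wirtinger (hf : IsSmooth f) : IsSmooth (wirtinger f) := by
  have h := ((hf.fderiv_apply 1).sub ((hf.fderiv_apply Complex.I).const_mul Complex.I)).const_mul
    (1 / 2)
  convert h using 2
  simp only [NonHolModular.wirtinger]; ring

lemma wirtingerBar (hf : IsSmooth f) : IsSmooth (wirtingerBar f) := by
  have h := ((hf.fderiv_apply 1).add ((hf.fderiv_apply Complex.I).const_mul Complex.I)).const_mul
    (1 / 2)
  convert h using 2
  simp only [NonHolModular.wirtingerBar]; ring

/-- The two Wirtinger derivatives commute. -/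
lemma wirtinger_wirtingerBar_comm (hf : IsSmooth f) :
    NonHolModular.wirtinger (NonHolModular.wirtingerBar f) =
      NonHolModular.wirtingerBar (NonHolModular.wirtinger f) := by
  funext z
  set T : ℂ → ℂ → ℂ := fun u v =>
    fderiv ℝ ((fun z : ℍ => fderiv ℝ (f ∘ ofComplex) (z : ℂ) u) ∘ ofComplex) (z : ℂ) v with hT
  have hd : ∀ u, DifferentiableAt ℝ
      ((fun z : ℍ => fderiv ℝ (f ∘ ofComplex) (z : ℂ) u) ∘ ofComplex) (z : ℂ) := fun u =>
    ((hf.fderiv_apply u).differentiableOn (by simp)).differentiableAt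
      (isOpen_upperHalfPlaneSet.mem_nhds z.im_pos)
  have hcd : ContDiffAt ℝ ∞ (f ∘ ofComplex) (z : ℂ) :=
    hf.contDiffAt (isOpen_upperHalfPlaneSet.mem_nhds z.im_pos)
  have hdd : DifferentiableAt ℝ (fderiv ℝ (f ∘ ofComplex)) (z : ℂ) :=
    (hcd.fderiv_right (m := 1) (by norm_cast)).differentiableAt (by simp)
  have hTeq : ∀ u v, T u v = fderiv ℝ (fderiv ℝ (f ∘ ofComplex)) (z : ℂ) v u := by
    intro u v
    have he : ((fun z : ℍ => fderiv ℝ (f ∘ ofComplex) (z : ℂ) u) ∘ ofComplex) =ᶠ[𝓝 (z : ℂ)]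
        fun w => fderiv ℝ (f ∘ ofComplex) w u := by
      filter_upwards [isOpen_upperHalfPlaneSet.mem_nhds z.im_pos] with w hw
      simp [ofComplex_apply_of_im_pos hw]
    rw [hT]
    simp only
    rw [he.fderiv_eq, fderiv_clm_apply hdd (by fun_prop)]
    simp
  -- `T u v` differentiates along `u`, then along `v`. The two composites differ only by exchanging
  -- `T 1 I` and `T I 1`, so symmetry of the second derivative is the whole content.
  have hsymm : T 1 Complex.I = T Complex.I 1 := by
    rw [hTeq, hTeq]
    exact (hcd.isSymmSndFDerivAt (by simp; norm_cast)).eq _ _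
  have hB : ∀ v, fderiv ℝ (NonHolModular.wirtingerBar f ∘ ofComplex) (z : ℂ) v =
      (T 1 v + Complex.I * T Complex.I v) / 2 := by
    intro v
    have h := ((hd 1).hasFDerivAt.add ((hd Complex.I).hasFDerivAt.const_mul Complex.I)).const_mul
      ((1 : ℂ) / 2)
    have h2 : HasFDerivAt (NonHolModular.wirtingerBar f ∘ ofComplex) _ (z : ℂ) :=
      h.congr_of_eventuallyEq (Filter.Eventually.of_forall fun w => by
        simp [NonHolModular.wirtingerBar]; ring)
    rw [h2.fderiv]
    simp [hT]; ring
  have hA : ∀ v, fderiv ℝ (NonHolModular.wirtinger f ∘ ofComplex) (z : ℂ) v =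
      (T 1 v - Complex.I * T Complex.I v) / 2 := by
    intro v
    have h := ((hd 1).hasFDerivAt.sub ((hd Complex.I).hasFDerivAt.const_mul Complex.I)).const_mul
      ((1 : ℂ) / 2)
    have h2 : HasFDerivAt (NonHolModular.wirtinger f ∘ ofComplex) _ (z : ℂ) :=
      h.congr_of_eventuallyEq (Filter.Eventually.of_forall fun w => by
        simp [NonHolModular.wirtinger]; ring)
    rw [h2.fderiv]
    simp [hT]; ring
  rw [NonHolModular.wirtinger, hB, hB]
  conv_rhs => rw [NonHolModular.wirtingerBar, hA, hA]
  rw [hsymm]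
  ring

end IsSmooth

lemma hasWirtingerAt_of_mdifferentiable {f : ℍ → ℂ} (hf : MDifferentiable 𝓘(ℂ) 𝓘(ℂ) f) (z : ℍ) :
    HasWirtingerAt f (deriv (f ∘ ofComplex) z) 0 z :=
  .of_hasDerivAt (UpperHalfPlane.mdifferentiableAt_iff.mp (hf z)).hasDerivAt

/-- Cauchy–Riemann: without the `v̄` term the real differential is multiplication by a complex
number. -/
lemma mdifferentiable_of_wirtingerBar_eq_zero {f : ℍ → ℂ} (hf : IsSmooth f)
    (h : ∀ z, wirtingerBar f z = 0) : MDifferentiable 𝓘(ℂ) 𝓘(ℂ) f := by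
  intro z
  rw [UpperHalfPlane.mdifferentiableAt_iff]
  have h1 : HasFDerivAt (f ∘ ofComplex) _ (z : ℂ) := hf.hasWirtingerAt z
  have h2 : HasDerivAt (f ∘ ofComplex) (wirtinger f z) (z : ℂ) := by
    rw [hasDerivAt_iff_hasFDerivAt]
    refine hasFDerivAt_of_restrictScalars ℝ h1 ?_
    ext v; simp [h z, mul_comm]
  exact h2.differentiableAt

/-! ### The operators `∂` and `∂̄` -/

lemma LL_eq (z : ℍ) : LL z = Real.pi * Complex.I * ((z : ℂ) - conj (z : ℂ)) := by
  rw [Complex.sub_conj, LL]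
  push_cast
  simp only [coe_im]
  linear_combination (-2 * Real.pi * (z.im : ℂ)) * Complex.I_mul_I

lemma LL_ne_zero (z : ℍ) : LL z ≠ 0 := by
  simp [LL, Real.pi_ne_zero, z.im_pos.ne']

lemma conj_LL (z : ℍ) : conj (LL z) = LL z := Complex.conj_ofReal _

lemma conjFun_conjFun (f : ℍ → ℂ) : conjFun (conjFun f) = f := by
  funext z; simp [conjFun]

lemma hasWirtingerAt_sub_conj (z : ℍ) :
    HasWirtingerAt (fun w => (w : ℂ) - conj (w : ℂ)) 1 (-1) z :=
  (HasWirtingerAt.coe.sub HasWirtingerAt.coe_conj).congr_coeff (by simp) (by simp)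

lemma hasWirtingerAt_LL (z : ℍ) :
    HasWirtingerAt LL (Real.pi * Complex.I) (-(Real.pi * Complex.I)) z := by
  rw [funext LL_eq]
  exact ((hasWirtingerAt_sub_conj z).const_mul _).congr_coeff (by simp) (by simp)

lemma isSmooth_sub_conj : IsSmooth fun z => (z : ℂ) - conj (z : ℂ) :=
  IsSmooth.coe.sub IsSmooth.coe.conjFun

lemma isSmooth_LL : IsSmooth LL := by
  rw [funext LL_eq]
  exact isSmooth_sub_conj.const_mul _

lemma HasWirtingerAt.del_eq {f : ℍ → ℂ} {A B : ℂ} {z : ℍ} (h : HasWirtingerAt f A B z) (r : ℤ) :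
    del r f z = ((z : ℂ) - conj (z : ℂ)) * A + r * f z := by
  rw [del, h.wirtinger_eq]

lemma HasWirtingerAt.delBar_eq {f : ℍ → ℂ} {A B : ℂ} {z : ℍ} (h : HasWirtingerAt f A B z)
    (s : ℤ) : delBar s f z = (conj (z : ℂ) - (z : ℂ)) * B + s * f z := by
  rw [delBar, h.wirtingerBar_eq]

namespace IsSmooth

variable {f g : ℍ → ℂ}

lemma del (hf : IsSmooth f) (r : ℤ) : IsSmooth (del r f) :=
  (isSmooth_sub_conj.mul hf.wirtinger).add (hf.const_mul r)

lemma delPow (hf : IsSmooth f) (r : ℤ) (k : ℕ) : IsSmooth (delPow r k f) := by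
  induction k with
  | zero => exact hf
  | succ k ih => exact ih.del _

/-- Conjugation exchanges the two Wirtinger derivatives. Facts about `∂̄` can thus be transported
from facts about `∂`. -/
lemma delBar_eq_conjFun (hf : IsSmooth f) (s : ℤ) :
    delBar s f = NonHolModular.conjFun (NonHolModular.del s (NonHolModular.conjFun f)) := by
  funext z
  rw [(hf.hasWirtingerAt z).delBar_eq, NonHolModular.conjFun,
    (hf.hasWirtingerAt z).conjFun.del_eq]
  simp [NonHolModular.conjFun]

lemma delBar (hf : IsSmooth f) (s : ℤ) : IsSmooth (delBar s f) := by
  rw [hf.delBar_eq_conjFun]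
  exact (hf.conjFun.del s).conjFun

lemma delBarPow (hf : IsSmooth f) (s : ℤ) (k : ℕ) : IsSmooth (delBarPow s k f) := by
  induction k with
  | zero => exact hf
  | succ k ih => exact ih.delBar _

lemma conjFun_del (hf : IsSmooth f) (r : ℤ) :
    NonHolModular.conjFun (NonHolModular.del r f) =
      NonHolModular.delBar r (NonHolModular.conjFun f) := by
  rw [hf.conjFun.delBar_eq_conjFun, conjFun_conjFun]

lemma conjFun_delBar (hf : IsSmooth f) (r : ℤ) :
    NonHolModular.conjFun (NonHolModular.delBar r f) =
      NonHolModular.del r (NonHolModular.conjFun f) := by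
  rw [hf.delBar_eq_conjFun, conjFun_conjFun]

lemma conjFun_delBarPow (hf : IsSmooth f) (r : ℤ) (k : ℕ) :
    NonHolModular.conjFun (NonHolModular.delBarPow r k f) =
      NonHolModular.delPow r k (NonHolModular.conjFun f) := by
  induction k with
  | zero => rfl
  | succ k ih =>
    rw [NonHolModular.delBarPow, NonHolModular.delPow, (hf.delBarPow r k).conjFun_delBar, ih]

end IsSmooth

/-! ### Linearity and commutation relations of `∂` and `∂̄`. -/

section Rules

variable {f g : ℍ → ℂ}

lemma del_sub (hf : IsSmooth f) (hg : IsSmooth g) (r : ℤ) :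
    del r (fun z => f z - g z) = fun z => del r f z - del r g z := by
  funext z
  rw [((hf.hasWirtingerAt z).sub (hg.hasWirtingerAt z)).del_eq, del, del]
  ring

lemma delBar_sub (hf : IsSmooth f) (hg : IsSmooth g) (s : ℤ) :
    delBar s (fun z => f z - g z) = fun z => delBar s f z - delBar s g z := by
  funext z
  rw [((hf.hasWirtingerAt z).sub (hg.hasWirtingerAt z)).delBar_eq, delBar, delBar]
  ring

lemma del_const_mul (hf : IsSmooth f) (c : ℂ) (r : ℤ) :
    del r (fun z => c * f z) = fun z => c * del r f z := by
  funext z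
  rw [((hf.hasWirtingerAt z).const_mul c).del_eq, del]
  ring

lemma delBar_const_mul (hf : IsSmooth f) (c : ℂ) (s : ℤ) :
    delBar s (fun z => c * f z) = fun z => c * delBar s f z := by
  funext z
  rw [((hf.hasWirtingerAt z).const_mul c).delBar_eq, delBar]
  ring

/-- `𝕃`, of weights `(-1, -1)`, is a constant for `∂`. -/
lemma del_LL_zpow_mul (hf : IsSmooth f) (k r : ℤ) :
    del r (fun z => LL z ^ k * f z) = fun z => LL z ^ k * del (r + k) f z := by
  funext z
  rw [(((hasWirtingerAt_LL z).zpow (LL_ne_zero z) k).mul (hf.hasWirtingerAt z)).del_eq, del]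
  have h : LL z ^ k = LL z ^ (k - 1) * LL z := by
    rw [← zpow_add_one₀ (LL_ne_zero z)]; simp
  rw [h]
  push_cast
  linear_combination (- k * LL z ^ (k - 1) * f z) * LL_eq z

/-- `𝕃`, of weights `(-1, -1)`, is a constant for `∂̄`. -/
lemma delBar_LL_zpow_mul (hf : IsSmooth f) (k s : ℤ) :
    delBar s (fun z => LL z ^ k * f z) = fun z => LL z ^ k * delBar (s + k) f z := by
  funext z
  rw [(((hasWirtingerAt_LL z).zpow (LL_ne_zero z) k).mul (hf.hasWirtingerAt z)).delBar_eq, delBar]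
  have h : LL z ^ k = LL z ^ (k - 1) * LL z := by
    rw [← zpow_add_one₀ (LL_ne_zero z)]; simp
  rw [h]
  push_cast
  linear_combination (- k * LL z ^ (k - 1) * f z) * LL_eq z

/-- `∂_a` and `∂_b` differ by the scalar `a - b`. This allows the factors of `∂^k` to be reordered
in Bol's identity. -/
lemma del_del_comm (hf : IsSmooth f) (a b : ℤ) : del a (del b f) = del b (del a f) := by
  have h : ∀ c : ℤ, del c f = fun z : ℍ =>
      ((z : ℂ) - conj (z : ℂ)) * wirtinger f z + c * f z := fun c => rfl
  have hs := isSmooth_sub_conj.mul hf.wirtinger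
  funext z
  have hw : ∀ c : ℤ, HasWirtingerAt (del c f) _ _ z := fun c =>
    (hs.hasWirtingerAt z).add ((hf.hasWirtingerAt z).const_mul c)
  rw [(hw a).del_eq, (hw b).del_eq, h, h]
  ring

lemma delPow_del_comm (hf : IsSmooth f) (a r : ℤ) (k : ℕ) :
    delPow r k (del a f) = del a (delPow r k f) := by
  induction k with
  | zero => rfl
  | succ k ih => rw [delPow, ih, del_del_comm (hf.delPow r k), delPow]

lemma delPow_succ_eq (r : ℤ) (k : ℕ) (f : ℍ → ℂ) :
    delPow r (k + 1) f = delPow (r + 1) k (del r f) := by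
  induction k with
  | zero => simp [delPow]
  | succ k ih =>
    rw [delPow, ih, delPow]
    congr 1
    push_cast; ring

/-- The commutator `[∂, ∂̄]` is multiplication by `r - s` in weights `(r, s)`. -/
lemma delBar_del (hf : IsSmooth f) (r s : ℤ) (z : ℍ) :
    delBar (s - 1) (del r f) z = del (r - 1) (delBar s f) z - (r - s) * f z := by
  have h1 : HasWirtingerAt (del r f) _ _ z :=
    ((hasWirtingerAt_sub_conj z).mul (hf.wirtinger.hasWirtingerAt z)).add
      ((hf.hasWirtingerAt z).const_mul r)
  have h2 : HasWirtingerAt (fun w : ℍ => conj (w : ℂ) - (w : ℂ)) (-1) 1 z :=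
    (HasWirtingerAt.coe_conj.sub HasWirtingerAt.coe).congr_coeff (by simp) (by simp)
  have h3 : HasWirtingerAt (delBar s f) _ _ z :=
    (h2.mul (hf.wirtingerBar.hasWirtingerAt z)).add ((hf.hasWirtingerAt z).const_mul s)
  rw [h1.delBar_eq, h3.del_eq, hf.wirtinger_wirtingerBar_comm, del, delBar]
  push_cast
  ring

end Rules

/-! ### Powers of `∂` on holomorphic functions and Bol's identity. -/

section Holomorphic

variable {f : ℍ → ℂ}

lemma delBar_zero_of_mdifferentiable (hf : MDifferentiable 𝓘(ℂ) 𝓘(ℂ) f) (z : ℍ) :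
    delBar 0 f z = 0 := by
  rw [(hasWirtingerAt_of_mdifferentiable hf z).delBar_eq]
  simp

/-- The `sl₂` computation for a vector killed by `∂̄`. Since `∂^j f` has weights `(j - n, -j)`,
moving `∂̄` past the factors of `∂^{k+1}` contributes `-∑_{j ≤ k} (2j - n) = (k + 1)(n - k)`. -/
lemma delBar_delPow_succ (hf : MDifferentiable 𝓘(ℂ) 𝓘(ℂ) f) (n : ℤ) (k : ℕ) (z : ℍ) :
    delBar (-(k + 1)) (delPow (-n) (k + 1) f) z = (k + 1) * (n - k) * delPow (-n) k f z := by
  have hs := IsSmooth.of_mdifferentiable hf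
  induction k generalizing z with
  | zero =>
    have h := delBar_del hs (-n) 0 z
    have h0 : delBar 0 f = fun z => 0 * f z := by
      funext w; rw [delBar_zero_of_mdifferentiable hf]; simp
    rw [h0, del_const_mul hs] at h
    simp only [delPow]
    simpa using h
  | succ k ih =>
    have h := delBar_del (hs.delPow (-n) (k + 1)) (-n + (k + 1 : ℕ)) (-(k + 1)) z
    rw [funext ih, del_const_mul (hs.delPow _ _)] at h
    have h1 : del (-n + (k + 1 : ℕ) - 1) (delPow (-n) k f) z = delPow (-n) (k + 1) f z := by
      rw [delPow]; congr 1; push_cast; ring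
    simp only [h1] at h
    rw [delPow]
    push_cast at h ⊢
    rw [show (-((k : ℤ) + 1 + 1)) = -((k : ℤ) + 1) - 1 by ring, h]
    ring

lemma normalizedDeriv_iterate_mdifferentiable (hf : MDifferentiable 𝓘(ℂ) 𝓘(ℂ) f) (k : ℕ) :
    MDifferentiable 𝓘(ℂ) 𝓘(ℂ) (Derivative.normalizedDerivOfComplex^[k] f) := by
  induction k with
  | zero => exact hf
  | succ k ih =>
    rw [Function.iterate_succ_apply']
    exact Derivative.normalizedDerivOfComplex_mdifferentiable ih

lemma hasWirtingerAt_normalizedDeriv (hf : MDifferentiable 𝓘(ℂ) 𝓘(ℂ) f) (z : ℍ) :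
    HasWirtingerAt f (2 * Real.pi * Complex.I * Derivative.normalizedDerivOfComplex f z) 0 z := by
  refine (hasWirtingerAt_of_mdifferentiable hf z).congr_coeff ?_ rfl
  rw [Derivative.normalizedDerivOfComplex, mul_inv_cancel_left₀]
  simp [Real.pi_ne_zero]

/-- Bol's identity. -/
lemma delPow_bol (hf : MDifferentiable 𝓘(ℂ) 𝓘(ℂ) f) (n : ℕ) (z : ℍ) :
    delPow (1 - n) n f z =
      (2 * LL z) ^ n * (Derivative.normalizedDerivOfComplex^[n] f) z := by
  have hs := IsSmooth.of_mdifferentiable hf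
  induction n generalizing z with
  | zero => simp [delPow]
  | succ n ih =>
    -- The innermost factor `∂_{-n}` is moved to the outside, leaving `∂^n` in starting weight `1 -
    -- n`, as in the induction hypothesis. Past `(2𝕃)^n` the factor `∂_{-n}` acts as `∂_0`, which is
    -- `2𝕃 D` on holomorphic functions.
    rw [delPow_succ_eq, delPow_del_comm hs]
    rw [show (1 - ((n + 1 : ℕ) : ℤ) + 1) = 1 - n by push_cast; ring, funext ih]
    have h1 : HasWirtingerAt (fun w => 2 * LL w) _ _ z := (hasWirtingerAt_LL z).const_mul 2
    have h2 := (h1.zpow (by simp [LL_ne_zero]) n).mul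
      (hasWirtingerAt_normalizedDeriv (normalizedDeriv_iterate_mdifferentiable hf n) z)
    simp only [zpow_natCast] at h2
    rw [h2.del_eq, Function.iterate_succ_apply']
    have hL : (2 * LL z) ≠ 0 := by simp [LL_ne_zero]
    have h3 : (2 * LL z) ^ n = (2 * LL z) ^ ((n : ℤ) - 1) * (2 * LL z) := by
      rw [← zpow_add_one₀ hL]; simp
    set E := Derivative.normalizedDerivOfComplex^[n] f
    have h4 := LL_eq z
    rw [pow_succ]
    push_cast
    set P := (2 * LL z) ^ ((n : ℤ) - 1)
    linear_combination (- n * E z) * h3 + (- 2 * n * P * E z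
      - 2 * (2 * LL z) ^ n * Derivative.normalizedDerivOfComplex E z) * h4

end Holomorphic

/-! ### Exponential growth at the cusp -/

/-- `f` grows at most exponentially in `Im z` as `Im z → ∞`. -/
def HasExpGrowth (f : ℍ → ℂ) : Prop :=
  ∃ B : ℕ, f =O[atImInfty] fun z => Real.exp (B * z.im)

lemma exp_mul_im_isBigO {B B' : ℕ} (h : B ≤ B') :
    (fun z : ℍ => Real.exp (B * z.im)) =O[atImInfty] fun z => Real.exp (B' * z.im) := by
  refine Asymptotics.IsBigO.of_bound 1 (Filter.Eventually.of_forall fun z => ?_)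
  have hz := z.im_pos.le
  simp only [Real.norm_eq_abs, Real.abs_exp, one_mul]
  gcongr

namespace HasExpGrowth

variable {f g : ℍ → ℂ}

lemma add (hf : HasExpGrowth f) (hg : HasExpGrowth g) : HasExpGrowth (fun z => f z + g z) := by
  obtain ⟨B, hB⟩ := hf
  obtain ⟨B', hB'⟩ := hg
  exact ⟨max B B', (hB.trans (exp_mul_im_isBigO (le_max_left _ _))).add
    (hB'.trans (exp_mul_im_isBigO (le_max_right _ _)))⟩

lemma mul (hf : HasExpGrowth f) (hg : HasExpGrowth g) : HasExpGrowth (fun z => f z * g z) := by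
  obtain ⟨B, hB⟩ := hf
  obtain ⟨B', hB'⟩ := hg
  refine ⟨B + B', (hB.mul hB').congr_right fun z => ?_⟩
  rw [← Real.exp_add]
  push_cast
  ring_nf

lemma const (c : ℂ) : HasExpGrowth (fun _ => c) :=
  ⟨0, by simpa using Asymptotics.isBigO_const_const c (one_ne_zero (α := ℝ)) atImInfty⟩

lemma const_mul (c : ℂ) (hf : HasExpGrowth f) : HasExpGrowth (fun z => c * f z) :=
  (const c).mul hf

lemma sub (hf : HasExpGrowth f) (hg : HasExpGrowth g) : HasExpGrowth (fun z => f z - g z) := by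
  simpa [sub_eq_add_neg] using hf.add (hg.const_mul (-1))

lemma sum {ι : Type*} (s : Finset ι) {F : ι → ℍ → ℂ} (h : ∀ i ∈ s, HasExpGrowth (F i)) :
    HasExpGrowth (fun z => ∑ i ∈ s, F i z) := by
  classical
  induction s using Finset.induction_on with
  | empty => simpa using const 0
  | insert i s hi ih =>
    simp only [Finset.sum_insert hi]
    exact (h i (Finset.mem_insert_self i s)).add
      (ih fun j hj => h j (Finset.mem_insert_of_mem hj))

lemma conjFun (hf : HasExpGrowth f) : HasExpGrowth (conjFun f) := by
  obtain ⟨B, hB⟩ := hf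
  exact ⟨B, hB.norm_left.congr_left (fun z => by simp [NonHolModular.conjFun]) |>.of_norm_left⟩

lemma pow (hf : HasExpGrowth f) (k : ℕ) : HasExpGrowth (fun z => f z ^ k) := by
  induction k with
  | zero => simpa using const 1
  | succ k ih => simpa only [pow_succ] using ih.mul hf

lemma LL : HasExpGrowth LL := by
  refine ⟨1, Asymptotics.IsBigO.of_bound (2 * Real.pi) (Filter.Eventually.of_forall fun z => ?_)⟩
  have h1 : ‖NonHolModular.LL z‖ = 2 * Real.pi * z.im := by
    rw [NonHolModular.LL, Complex.norm_real, Real.norm_eq_abs, neg_mul, neg_mul, abs_neg,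
      abs_of_nonneg (by have := z.im_pos; positivity)]
  rw [h1, Real.norm_eq_abs, Real.abs_exp]
  have := Real.add_one_le_exp ((1 : ℕ) * z.im)
  simp only [Nat.cast_one, one_mul] at this ⊢
  have hpi := Real.pi_pos
  exact mul_le_mul_of_nonneg_left (by linarith) (by positivity)

lemma LL_inv : HasExpGrowth (fun z => (NonHolModular.LL z)⁻¹) := by
  refine ⟨0, Asymptotics.IsBigO.of_bound 1 ?_⟩
  refine (atImInfty_mem _).mpr ⟨1, fun z hz => ?_⟩
  have h1 : ‖NonHolModular.LL z‖ = 2 * Real.pi * z.im := by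
    rw [NonHolModular.LL, Complex.norm_real, Real.norm_eq_abs, neg_mul, neg_mul, abs_neg,
      abs_of_nonneg (by have := z.im_pos; positivity)]
  simp only [Set.mem_ofPred_eq, norm_inv, h1]
  simp only [Nat.cast_zero, zero_mul, Real.exp_zero, norm_one, mul_one]
  apply inv_le_one_of_one_le₀
  nlinarith [Real.pi_gt_three]

lemma LL_zpow (k : ℤ) : HasExpGrowth (fun z => NonHolModular.LL z ^ k) := by
  cases k with
  | ofNat m => simpa using LL.pow m
  | negSucc m => simpa [zpow_negSucc] using LL_inv.pow (m + 1)

lemma comp (hf : HasExpGrowth f) {α : ℍ → ℍ} (hα : Filter.Tendsto α atImInfty atImInfty) (m : ℕ)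
    (hm : ∀ z, (α z).im ≤ m * z.im) : HasExpGrowth (fun z => f (α z)) := by
  obtain ⟨B, hB⟩ := hf
  refine ⟨B * m, (hB.comp_tendsto hα).trans
    (Asymptotics.IsBigO.of_bound 1 (Filter.Eventually.of_forall fun z => ?_))⟩
  simp only [Function.comp_apply, Real.norm_eq_abs, Real.abs_exp, one_mul, Nat.cast_mul, mul_assoc]
  have := hm z
  gcongr

/-- Cauchy's estimate on the unit disc around `z`: `Im` changes there by at most `1`, which costs a
factor `exp B`. -/
lemma normalizedDeriv (hd : MDifferentiable 𝓘(ℂ) 𝓘(ℂ) f) (hf : HasExpGrowth f) :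
    HasExpGrowth (Derivative.normalizedDerivOfComplex f) := by
  obtain ⟨B, hB⟩ := hf
  obtain ⟨C, hC0, hC⟩ := hB.exists_pos
  obtain ⟨A, hA⟩ := (atImInfty_mem _).mp hC.bound
  have hderiv : HasExpGrowth (fun z : ℍ => deriv (f ∘ ofComplex) (z : ℂ)) := by
    -- Above height `max A 0 + 2` the closed unit disc stays in the upper half plane and in the
    -- region `Im ≥ A` where the bound on `f` holds.
    refine ⟨B, Asymptotics.IsBigO.of_bound (C * Real.exp B)
      ((atImInfty_mem _).mpr ⟨max A 0 + 2, fun z hz => ?_⟩)⟩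
    have hhol := UpperHalfPlane.mdifferentiable_iff.mp hd
    have him : ∀ w ∈ Metric.closedBall (z : ℂ) 1, z.im - 1 ≤ w.im ∧ w.im ≤ z.im + 1 := by
      intro w hw
      have h1 := (Complex.abs_im_le_norm (w - z)).trans (mem_closedBall_iff_norm.mp hw)
      rw [Complex.sub_im, coe_im, abs_le] at h1
      constructor <;> linarith
    have hmax1 := le_max_left A 0
    have hmax2 := le_max_right A 0
    have hdc : DiffContOnCl ℂ (f ∘ ofComplex) (Metric.ball (z : ℂ) 1) := by
      refine DifferentiableOn.diffContOnCl (hhol.mono ?_)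
      rw [closure_ball _ one_ne_zero]
      intro w hw
      have := (him w hw).1
      show 0 < w.im
      linarith
    have hb := Complex.norm_deriv_le_of_forall_mem_sphere_norm_le one_pos hdc
      (C := C * Real.exp B * Real.exp (B * z.im)) (fun w hw => ?_)
    · simpa using hb
    have hw' := him w (Metric.sphere_subset_closedBall hw)
    have hwpos : 0 < w.im := by linarith
    have h2 := hA ⟨w, hwpos⟩ (by show A ≤ w.im; linarith)
    simp only [Set.mem_ofPred_eq, Real.norm_eq_abs, Real.abs_exp] at h2
    rw [Function.comp_apply, ofComplex_apply_of_im_pos hwpos]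
    refine h2.trans ?_
    rw [mul_assoc, ← Real.exp_add]
    gcongr
    have h3 : (⟨w, hwpos⟩ : ℍ).im = w.im := rfl
    rw [h3]
    nlinarith [hw'.2, (Nat.cast_nonneg B : (0 : ℝ) ≤ B)]
  exact hderiv.const_mul _

end HasExpGrowth

/-- Sums of products of powers of `𝕃` with holomorphic functions of exponential growth. -/
inductive IsQuasiHolomorphic : (ℍ → ℂ) → Prop
  | zpow_mul (k : ℤ) (h : ℍ → ℂ) : MDifferentiable 𝓘(ℂ) 𝓘(ℂ) h → HasExpGrowth h →
      IsQuasiHolomorphic (fun z => LL z ^ k * h z)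
  | add (F G : ℍ → ℂ) : IsQuasiHolomorphic F → IsQuasiHolomorphic G →
      IsQuasiHolomorphic (fun z => F z + G z)

namespace IsQuasiHolomorphic

variable {F : ℍ → ℂ}

lemma isSmooth (hF : IsQuasiHolomorphic F) : IsSmooth F := by
  induction hF with
  | zpow_mul k h hd _ => exact (isSmooth_LL.zpow LL_ne_zero k).mul (.of_mdifferentiable hd)
  | add F G _ _ hF hG => exact hF.add hG

lemma hasExpGrowth (hF : IsQuasiHolomorphic F) : HasExpGrowth F := by
  induction hF with
  | zpow_mul k h _ hg => exact (HasExpGrowth.LL_zpow k).mul hg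
  | add F G _ _ hF hG => exact hF.add hG

/-- `∂_r (𝕃^k h) = (r + k) 𝕃^k h + 2 𝕃^{k+1} D h`. The class exists for this closure property:
growth of a merely smooth function says nothing about its derivatives, whereas here only holomorphic
factors are differentiated. -/
lemma del (hF : IsQuasiHolomorphic F) (r : ℤ) : IsQuasiHolomorphic (del r F) := by
  induction hF with
  | zpow_mul k h hd hg =>
    have h1 := zpow_mul k (fun z => ((r + k : ℤ) : ℂ) * h z) (hd.const_smul ((r + k : ℤ) : ℂ))
      (hg.const_mul _)
    have h2 := zpow_mul (k + 1) (fun z => 2 * Derivative.normalizedDerivOfComplex h z)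
      ((Derivative.normalizedDerivOfComplex_mdifferentiable hd).const_smul (2 : ℂ))
      ((hg.normalizedDeriv hd).const_mul 2)
    convert add _ _ h1 h2 using 1
    rw [del_LL_zpow_mul (.of_mdifferentiable hd)]
    funext z
    rw [(hasWirtingerAt_normalizedDeriv hd z).del_eq, zpow_add_one₀ (LL_ne_zero z)]
    linear_combination
      (-2 * LL z ^ k * Derivative.normalizedDerivOfComplex h z) * LL_eq z
  | add F G hF hG ihF ihG =>
    convert add _ _ ihF ihG using 1
    funext z
    rw [((hF.isSmooth.hasWirtingerAt z).add (hG.isSmooth.hasWirtingerAt z)).del_eq,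
      NonHolModular.del, NonHolModular.del]
    ring

lemma delPow (hF : IsQuasiHolomorphic F) (r : ℤ) (k : ℕ) :
    IsQuasiHolomorphic (delPow r k F) := by
  induction k with
  | zero => exact hF
  | succ k ih => exact ih.del _

end IsQuasiHolomorphic

lemma HasExpGrowth.delPow {f : ℍ → ℂ} (hf : HasExpGrowth f) (hd : MDifferentiable 𝓘(ℂ) 𝓘(ℂ) f)
    (r : ℤ) (k : ℕ) : HasExpGrowth (delPow r k f) := by
  have h := IsQuasiHolomorphic.zpow_mul 0 f hd hf
  simp only [zpow_zero, one_mul] at h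
  exact (h.delPow r k).hasExpGrowth

/-! ### Fourier expansions -/

lemma norm_qParam (z : ℍ) : ‖qParam z‖ = Real.exp (-2 * Real.pi * z.im) := by
  rw [qParam, Complex.norm_exp]
  simp

lemma qParam_ne_zero (z : ℍ) : qParam z ≠ 0 := Complex.exp_ne_zero _

/-- For `Im z ≥ 1` one has `|q(z)| ≤ |q(i)|`, so each term is at most its value at `i` times
`(|q(i)| / |q(z)|)^N`. Absolute convergence at the single point `i` then bounds the sum, and
`|q(z)|^{-N} = exp (2πN Im z)`. -/
lemma hasExpGrowth_of_hasSum {ι : Type*} {F : ℍ → ℂ} (t : ι → ℍ → ℂ) (b : ι → ℝ) (e : ι → ℕ)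
    (N : ℕ) (ht : ∀ i z, ‖t i z‖ = b i * ‖qParam z‖ ^ ((e i : ℤ) - N))
    (hF : ∀ z, HasSum (fun i => t i z) (F z)) : HasExpGrowth F := by
  set ρ := ‖qParam I‖
  have hρ : 0 < ρ := norm_pos_iff.mpr (qParam_ne_zero _)
  have hsum0 : Summable fun i => ‖t i I‖ := (hF I).summable.norm
  have hb : ∀ i, 0 ≤ b i := fun i => by
    have h := norm_nonneg (t i I)
    rw [ht] at h
    exact nonneg_of_mul_nonneg_left h (zpow_pos hρ _)
  obtain ⟨B, hB⟩ := exists_nat_ge (2 * Real.pi * N)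
  refine ⟨B, Asymptotics.IsBigO.of_bound ((∑' i, ‖t i I‖) * ρ ^ N)
    ((atImInfty_mem _).mpr ⟨1, fun z hz => ?_⟩)⟩
  set σ := ‖qParam z‖ with hσdef
  have hσ : 0 < σ := norm_pos_iff.mpr (qParam_ne_zero _)
  have hσρ : σ ≤ ρ := by
    simp only [σ, ρ, norm_qParam, I_im]
    apply Real.exp_le_exp.mpr
    nlinarith [Real.pi_pos]
  have hσN : (σ ^ N)⁻¹ ≤ Real.exp (B * z.im) := by
    rw [hσdef, norm_qParam, ← Real.exp_nat_mul, ← Real.exp_neg]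
    apply Real.exp_le_exp.mpr
    nlinarith [z.im_pos]
  have hterm : ∀ i, ‖t i z‖ ≤ ‖t i I‖ * (ρ ^ N * (σ ^ N)⁻¹) := by
    intro i
    rw [ht, ht, zpow_sub₀ hσ.ne', zpow_sub₀ hρ.ne']
    simp only [zpow_natCast]
    have h1 : σ ^ e i ≤ ρ ^ e i := by gcongr
    have h2 : b i * (ρ ^ e i / ρ ^ N) * (ρ ^ N * (σ ^ N)⁻¹) = b i * (ρ ^ e i / σ ^ N) := by
      field_simp
    rw [h2]
    have := hb i
    gcongr
  have hle : ‖F z‖ ≤ ∑' i, ‖t i I‖ * (ρ ^ N * (σ ^ N)⁻¹) := by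
    rw [← (hF z).tsum_eq]
    exact tsum_of_norm_bounded (hsum0.mul_right _).hasSum hterm
  rw [tsum_mul_right] at hle
  simp only [Set.mem_ofPred_eq, Real.norm_eq_abs, Real.abs_exp]
  refine hle.trans ?_
  rw [mul_assoc]
  have hS : 0 ≤ ∑' i, ‖t i I‖ := tsum_nonneg fun i => norm_nonneg _
  gcongr

lemma IsWeaklyHolomorphic.hasExpGrowth {k : ℤ} {f : ℍ → ℂ} (hf : IsWeaklyHolomorphic k f) :
    HasExpGrowth f := by
  obtain ⟨N, a, ha⟩ := hf.expansion
  exact hasExpGrowth_of_hasSum (fun j z => a j * qParam z ^ ((j : ℤ) - N)) (fun j => ‖a j‖) id N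
    (fun j z => by simp) ha

lemma IsRealAnalyticModular.hasExpGrowth {r s : ℤ} {f : ℍ → ℂ}
    (hf : IsRealAnalyticModular r s f) : HasExpGrowth f := by
  obtain ⟨M, N, a, F, hF, hfF⟩ := hf.expansion
  rw [funext hfF]
  refine HasExpGrowth.sum _ fun k hk => (HasExpGrowth.LL_zpow k).mul ?_
  -- Since `|q̄| = |q|`, the two exponents add up and the pole order doubles.
  refine hasExpGrowth_of_hasSum _ (fun p => ‖a k p‖) (fun p : ℕ × ℕ => p.1 + p.2) (2 * N)
    (fun p z => ?_) (hF k hk)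
  rw [norm_mul, norm_mul, norm_zpow, norm_zpow, RCLike.norm_conj, mul_assoc,
    ← zpow_add₀ (norm_ne_zero_iff.mpr (qParam_ne_zero z))]
  push_cast
  ring_nf

lemma IsRealAnalyticModular.isSmooth {r s : ℤ} {f : ℍ → ℂ}
    (hf : IsRealAnalyticModular r s f) : IsSmooth f :=
  hf.analytic.contDiffOn isOpen_upperHalfPlaneSet.uniqueDiffOn

lemma isModular_periodic {r s : ℤ} {f : ℍ → ℂ} (hf : IsModular r s f) :
    Function.Periodic (f ∘ ofComplex) ((1 : ℝ) : ℂ) := by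
  intro w
  by_cases hw : 0 < w.im
  · have hw' : 0 < (w + ((1 : ℝ) : ℂ)).im := by simpa using hw
    have h := hf ModularGroup.T ⟨w, hw⟩
    simp only [Function.comp_apply, ofComplex_apply_of_im_pos hw, ofComplex_apply_of_im_pos hw']
    have h2 : ModularGroup.T • (⟨w, hw⟩ : ℍ) = ⟨w + ((1 : ℝ) : ℂ), hw'⟩ := by
      rw [modular_T_smul]
      apply UpperHalfPlane.ext
      simp [add_comm]
    rw [h2] at h
    rw [h]
    simp [ModularGroup.T]
  -- Outside the upper half plane `ofComplex` takes a constant default value, so periodicity holds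
  -- on all of `ℂ`.
  · rw [Function.comp_apply, Function.comp_apply, ofComplex_apply_eq_of_im_nonpos
      (w' := w) (by simpa using hw) (by simpa using hw)]

lemma mdifferentiable_qParam_zpow (k : ℤ) :
    MDifferentiable 𝓘(ℂ) 𝓘(ℂ) (fun z => qParam z ^ k) := by
  rw [UpperHalfPlane.mdifferentiable_iff]
  have h : DifferentiableOn ℂ (fun w : ℂ => Complex.exp (2 * Real.pi * Complex.I * w) ^ k)
      {z : ℂ | 0 < z.im} := by
    intro w _
    refine DifferentiableAt.differentiableWithinAt ?_
    refine DifferentiableAt.zpow (by fun_prop) (Or.inl (Complex.exp_ne_zero _))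
  refine h.congr fun w hw => ?_
  simp [qParam, ofComplex_apply_of_im_pos hw]

/-- A holomorphic modular function of exponential growth at the cusp is weakly holomorphic. -/
lemma isWeaklyHolomorphic_of_hasExpGrowth {k : ℤ} {f : ℍ → ℂ}
    (hd : MDifferentiable 𝓘(ℂ) 𝓘(ℂ) f) (hm : IsModular k 0 f) (hg : HasExpGrowth f) :
    IsWeaklyHolomorphic k f := by
  refine ⟨hd, hm, ?_⟩
  obtain ⟨N, hN⟩ := hg
  -- As `2π > 1`, the decay of `q^N` beats the growth `exp (N Im z)`. So `q^N f` is periodic and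
  -- bounded at the cusp, and its ordinary `q`-expansion is divided by `q^N`.
  have hper : Function.Periodic ((fun z => qParam z ^ (N : ℤ) * f z) ∘ ofComplex)
      ((1 : ℝ) : ℂ) := by
    intro w
    have hf := isModular_periodic hm w
    simp only [Function.comp_apply] at hf ⊢
    rw [hf]
    congr 2
    by_cases hw : 0 < w.im
    · have hw' : 0 < (w + ((1 : ℝ) : ℂ)).im := by simpa using hw
      simp only [ofComplex_apply_of_im_pos hw, ofComplex_apply_of_im_pos hw', qParam]
      rw [Complex.ofReal_one, mul_add, mul_one, Complex.exp_add, Complex.exp_two_pi_mul_I, mul_one]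
    · rw [ofComplex_apply_eq_of_im_nonpos (w' := w) (by simpa using hw) (by simpa using hw)]
  have hbdd : IsBoundedAtImInfty (fun z => qParam z ^ (N : ℤ) * f z) := by
    have h1 : (fun z => qParam z ^ (N : ℤ)) =O[atImInfty] fun z => Real.exp (-(N * z.im)) := by
      refine Asymptotics.IsBigO.of_bound 1 (Filter.Eventually.of_forall fun z => ?_)
      rw [zpow_natCast, norm_pow, norm_qParam, Real.norm_eq_abs, Real.abs_exp, one_mul,
        ← Real.exp_nat_mul]
      apply Real.exp_le_exp.mpr
      have h3 : (0 : ℝ) ≤ N * z.im := mul_nonneg N.cast_nonneg z.im_pos.le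
      nlinarith [Real.pi_gt_three]
    have h2 := h1.mul hN
    refine h2.congr_right fun z => ?_
    rw [← Real.exp_add]
    simp
  have hdq : MDifferentiable 𝓘(ℂ) 𝓘(ℂ) (fun z => qParam z ^ (N : ℤ) * f z) :=
    (mdifferentiable_qParam_zpow N).mul hd
  refine ⟨N, fun j => (UpperHalfPlane.qExpansion 1 fun z => qParam z ^ (N : ℤ) * f z).coeff j,
    fun z => ?_⟩
  have h := UpperHalfPlane.hasSum_qExpansion one_pos hper hdq hbdd z
  have h2 := h.mul_left (qParam z ^ (-(N : ℤ)))
  have hq0 := qParam_ne_zero z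
  rw [← mul_assoc, ← zpow_add₀ hq0, neg_add_cancel, zpow_zero, one_mul] at h2
  have hq : Function.Periodic.qParam 1 (z : ℂ) = qParam z := by
    simp [Function.Periodic.qParam, qParam]
  refine (congrArg (HasSum · (f z)) (funext fun j => ?_)).mpr h2
  rw [hq, sub_eq_neg_add, zpow_add₀ hq0, zpow_natCast, smul_eq_mul]
  ring

/-! ### Hecke operators -/

/-- The Möbius transformation attached to an integral matrix of positive determinant. -/
def moebius (α : Matrix (Fin 2) (Fin 2) ℤ) (z : ℍ) : ℍ :=
  ofComplex (((α 0 0 : ℂ) * z + (α 0 1 : ℂ)) / ((α 1 0 : ℂ) * z + (α 1 1 : ℂ)))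

/-! ### Möbius transformations of integral matrices of positive determinant. -/

section Moebius

variable {m : ℕ} {α : Matrix (Fin 2) (Fin 2) ℤ}

lemma moebius_denom_ne_zero (hm : 1 ≤ m) (hα : α.det = m) (z : ℍ) :
    (α 1 0 : ℂ) * z + (α 1 1 : ℂ) ≠ 0 := by
  intro h
  have him := congrArg Complex.im h
  have hre := congrArg Complex.re h
  simp only [Complex.add_im, Complex.mul_im, Complex.intCast_re, Complex.intCast_im, coe_im,
    zero_mul, add_zero, Complex.zero_im, mul_eq_zero, z.im_pos.ne', or_false, Int.cast_eq_zero]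
    at him
  simp only [him, Int.cast_zero, zero_mul, zero_add, Complex.intCast_re, Complex.zero_re,
    Int.cast_eq_zero] at hre
  rw [Matrix.det_fin_two, him, hre] at hα
  simp only [mul_zero, sub_zero] at hα
  omega

lemma moebius_denom_conj (α : Matrix (Fin 2) (Fin 2) ℤ) (z : ℍ) :
    (α 1 0 : ℂ) * conj (z : ℂ) + (α 1 1 : ℂ) = conj ((α 1 0 : ℂ) * z + (α 1 1 : ℂ)) := by
  simp

lemma moebius_denom_conj_ne_zero (hm : 1 ≤ m) (hα : α.det = m) (z : ℍ) :
    (α 1 0 : ℂ) * conj (z : ℂ) + (α 1 1 : ℂ) ≠ 0 := by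
  rw [moebius_denom_conj]
  simpa only [ne_eq, map_eq_zero] using moebius_denom_ne_zero hm hα z

/-- Stated for the bare quotient, because positivity of its imaginary part, needed to identify it
with `moebius α z`, is deduced from this identity. -/
lemma moebius_sub_conj_aux (hm : 1 ≤ m) (hα : α.det = m) (z : ℍ) :
    ((α 0 0 : ℂ) * z + (α 0 1 : ℂ)) / ((α 1 0 : ℂ) * z + (α 1 1 : ℂ)) -
      conj (((α 0 0 : ℂ) * z + (α 0 1 : ℂ)) / ((α 1 0 : ℂ) * z + (α 1 1 : ℂ))) =
    m * ((z : ℂ) - conj (z : ℂ)) / (((α 1 0 : ℂ) * z + (α 1 1 : ℂ)) *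
      ((α 1 0 : ℂ) * conj (z : ℂ) + (α 1 1 : ℂ))) := by
  have h1 := moebius_denom_ne_zero hm hα z
  have h2 := moebius_denom_conj_ne_zero hm hα z
  have h3 : (α 0 0 : ℂ) * α 1 1 - α 0 1 * α 1 0 = m := by
    rw [Matrix.det_fin_two] at hα
    exact_mod_cast hα
  simp only [map_div₀, map_add, map_mul, map_intCast]
  rw [div_sub_div _ _ h1 h2, ← h3]
  congr 1
  ring

lemma im_moebius_aux (hm : 1 ≤ m) (hα : α.det = m) (z : ℍ) :
    (((α 0 0 : ℂ) * z + (α 0 1 : ℂ)) / ((α 1 0 : ℂ) * z + (α 1 1 : ℂ))).im =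
      m * z.im / Complex.normSq ((α 1 0 : ℂ) * z + (α 1 1 : ℂ)) := by
  have h := moebius_sub_conj_aux hm hα z
  rw [Complex.sub_conj, Complex.sub_conj, moebius_denom_conj, Complex.mul_conj, coe_im] at h
  have h2 : ((((((α 0 0 : ℂ) * z + (α 0 1 : ℂ)) / ((α 1 0 : ℂ) * z + (α 1 1 : ℂ))).im : ℝ) : ℂ) *
      (2 * Complex.I)) = ((m * z.im / Complex.normSq ((α 1 0 : ℂ) * z + (α 1 1 : ℂ)) : ℝ) : ℂ) *
      (2 * Complex.I) := by
    push_cast at h ⊢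
    linear_combination h
  have h3 := mul_right_cancel₀ (by simp) h2
  exact_mod_cast h3

lemma coe_moebius (hm : 1 ≤ m) (hα : α.det = m) (z : ℍ) :
    (moebius α z : ℂ) =
      ((α 0 0 : ℂ) * z + (α 0 1 : ℂ)) / ((α 1 0 : ℂ) * z + (α 1 1 : ℂ)) := by
  have hpos : 0 < (((α 0 0 : ℂ) * z + (α 0 1 : ℂ)) / ((α 1 0 : ℂ) * z + (α 1 1 : ℂ))).im := by
    rw [im_moebius_aux hm hα]
    have h1 := Complex.normSq_pos.mpr (moebius_denom_ne_zero hm hα z)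
    have h2 := z.im_pos
    have h3 : (0 : ℝ) < m := by exact_mod_cast hm
    positivity
  rw [moebius, ofComplex_apply_of_im_pos hpos]

lemma im_moebius (hm : 1 ≤ m) (hα : α.det = m) (z : ℍ) :
    (moebius α z).im = m * z.im / Complex.normSq ((α 1 0 : ℂ) * z + (α 1 1 : ℂ)) := by
  rw [← coe_im, coe_moebius hm hα, im_moebius_aux hm hα]

lemma moebius_sub_conj (hm : 1 ≤ m) (hα : α.det = m) (z : ℍ) :
    (moebius α z : ℂ) - conj (moebius α z : ℂ) =
    m * ((z : ℂ) - conj (z : ℂ)) / (((α 1 0 : ℂ) * z + (α 1 1 : ℂ)) *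
      ((α 1 0 : ℂ) * conj (z : ℂ) + (α 1 1 : ℂ))) := by
  rw [coe_moebius hm hα, moebius_sub_conj_aux hm hα]

lemma LL_moebius (hm : 1 ≤ m) (hα : α.det = m) (z : ℍ) :
    LL (moebius α z) = m * LL z / (((α 1 0 : ℂ) * z + (α 1 1 : ℂ)) *
      ((α 1 0 : ℂ) * conj (z : ℂ) + (α 1 1 : ℂ))) := by
  rw [LL_eq, LL_eq, moebius_sub_conj hm hα]
  ring

lemma hasDerivAt_moebius (hm : 1 ≤ m) (hα : α.det = m) (z : ℍ) :
    HasDerivAt ((fun w => (moebius α w : ℂ)) ∘ ofComplex)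
      (m / ((α 1 0 : ℂ) * z + (α 1 1 : ℂ)) ^ 2) (z : ℂ) := by
  have h1 := moebius_denom_ne_zero hm hα z
  have hd : ∀ a b : ℂ, HasDerivAt (fun w : ℂ => a * w + b) a (z : ℂ) := fun a b => by
    simpa using ((hasDerivAt_id (z : ℂ)).const_mul a).add_const b
  have h := (hd (α 0 0) (α 0 1)).div (hd (α 1 0) (α 1 1)) h1
  have h3 : (α 0 0 : ℂ) * α 1 1 - α 0 1 * α 1 0 = m := by
    rw [Matrix.det_fin_two] at hα
    exact_mod_cast hα
  have h4 := h.congr_deriv (g' := m / ((α 1 0 : ℂ) * z + (α 1 1 : ℂ)) ^ 2) (by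
    rw [← h3]; congr 1; ring)
  refine h4.congr_of_eventuallyEq ?_
  filter_upwards [isOpen_upperHalfPlaneSet.mem_nhds z.im_pos] with w hw
  simp [coe_moebius hm hα, ofComplex_apply_of_im_pos hw]

lemma isSmooth_moebius (hm : 1 ≤ m) (hα : α.det = m) : IsSmooth fun z => (moebius α z : ℂ) :=
  IsSmooth.of_mdifferentiable fun z =>
    UpperHalfPlane.mdifferentiableAt_iff.mpr (hasDerivAt_moebius hm hα z).differentiableAt

end Moebius

/-! ### Individual summands of the Hecke operators. -/

section HeckeTerm

variable {m : ℕ} {α : Matrix (Fin 2) (Fin 2) ℤ} {f : ℍ → ℂ}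

lemma heckeTerm_eq (m : ℕ) (r s : ℤ) (f : ℍ → ℂ) (α : Matrix (Fin 2) (Fin 2) ℤ) :
    heckeTerm m r s f α = fun z : ℍ => (m : ℂ) ^ (r + s - 1) *
      (((α 1 0 : ℂ) * z + (α 1 1 : ℂ)) ^ (-r) *
        (((α 1 0 : ℂ) * conj (z : ℂ) + (α 1 1 : ℂ)) ^ (-s) * f (moebius α z))) := by
  funext z
  rw [heckeTerm, moebius, zpow_neg, zpow_neg, div_eq_mul_inv, mul_inv]
  ring

lemma hasWirtingerAt_denom (α : Matrix (Fin 2) (Fin 2) ℤ) (z : ℍ) :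
    HasWirtingerAt (fun z : ℍ => (α 1 0 : ℂ) * z + (α 1 1 : ℂ)) (α 1 0) 0 z :=
  ((HasWirtingerAt.coe.const_mul _).add (.const _)).congr_coeff (by simp) (by simp)

lemma hasWirtingerAt_denom_conj (α : Matrix (Fin 2) (Fin 2) ℤ) (z : ℍ) :
    HasWirtingerAt (fun z : ℍ => (α 1 0 : ℂ) * conj (z : ℂ) + (α 1 1 : ℂ)) 0 (α 1 0) z :=
  ((HasWirtingerAt.coe_conj.const_mul _).add (.const _)).congr_coeff (by simp) (by simp)

lemma IsSmooth.heckeTerm (hm : 1 ≤ m) (hα : α.det = m) (hf : IsSmooth f) (r s : ℤ) :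
    IsSmooth (heckeTerm m r s f α) := by
  rw [heckeTerm_eq]
  have h1 : IsSmooth (fun z : ℍ => (α 1 0 : ℂ) * z + (α 1 1 : ℂ)) :=
    (IsSmooth.coe.const_mul _).add (.const _)
  have h2 : IsSmooth (fun z : ℍ => (α 1 0 : ℂ) * conj (z : ℂ) + (α 1 1 : ℂ)) :=
    (IsSmooth.coe.conjFun.const_mul _).add (.const _)
  exact ((h1.zpow (moebius_denom_ne_zero hm hα) _).mul
    ((h2.zpow (moebius_denom_conj_ne_zero hm hα) _).mul
      (hf.comp (isSmooth_moebius hm hα)))).const_mul _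

/-- Let `J = cz + d` and `K = cz̄ + d`. Differentiating `J^{-r}` gives `-rc(z - z̄)`, which combines
with `rJ` to `rK` because `J = K + c(z - z̄)`; the chain rule term fits since `αz - conj (αz) = m(z
- z̄)/(JK)`. The power of `m` depends only on `r + s`, which `∂` preserves. -/
lemma del_heckeTerm (hm : 1 ≤ m) (hα : α.det = m) (hf : IsSmooth f) (r s : ℤ) :
    del r (heckeTerm m r s f α) = heckeTerm m (r + 1) (s - 1) (del r f) α := by
  funext z
  have hJ := moebius_denom_ne_zero hm hα z
  have hJb := moebius_denom_conj_ne_zero hm hα z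
  have h := ((((hasWirtingerAt_denom α z).zpow hJ (-r)).mul
    (((hasWirtingerAt_denom_conj α z).zpow hJb (-s)).mul
      ((hf.hasWirtingerAt (moebius α z)).comp (hasDerivAt_moebius hm hα z)))).const_mul
        ((m : ℂ) ^ (r + s - 1)))
  rw [heckeTerm_eq, heckeTerm_eq, h.del_eq]
  simp only [del, moebius_sub_conj hm hα]
  have hJJ : (α 1 0 : ℂ) * z + (α 1 1 : ℂ) =
      ((α 1 0 : ℂ) * conj (z : ℂ) + (α 1 1 : ℂ)) + α 1 0 * ((z : ℂ) - conj (z : ℂ)) := by ring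
  generalize (α 1 0 : ℂ) * z + (α 1 1 : ℂ) = J at hJ hJJ ⊢
  generalize (α 1 0 : ℂ) * conj (z : ℂ) + (α 1 1 : ℂ) = K at hJb hJJ ⊢
  rw [show r + 1 + (s - 1) - 1 = r + s - 1 by ring, show -(r + 1) = -r - 1 by ring,
    show -(s - 1) = -s + 1 by ring, zpow_add_one₀ hJb]
  have hP : J ^ (-r) = J ^ (-r - 1) * J := by rw [← zpow_add_one₀ hJ]; simp
  rw [hP]
  generalize J ^ (-r - 1) = P
  generalize K ^ (-s) = Q
  generalize (m : ℂ) ^ (r + s - 1) = R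
  have hm0 : (m : ℂ) ≠ 0 := by
    have : m ≠ 0 := by omega
    exact_mod_cast this
  field_simp
  push_cast
  linear_combination (R * P * Q * r * f (moebius α z) * J) * hJJ

lemma conjFun_heckeTerm (m : ℕ) (r s : ℤ) (f : ℍ → ℂ) (α : Matrix (Fin 2) (Fin 2) ℤ) :
    conjFun (heckeTerm m r s f α) = heckeTerm m s r (conjFun f) α := by
  funext z
  rw [heckeTerm_eq, heckeTerm_eq]
  simp only [conjFun, map_mul, map_zpow₀, map_add, map_intCast, Complex.conj_conj, map_natCast]
  rw [add_comm s r]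
  ring

/-- `𝕃(αz) = m𝕃/(JK)` contributes `m`, and lowering both weights by one contributes `m^{-2}`. This
is the source of `λ/m` as eigenvalue on `X_{r,s}`. -/
lemma heckeTerm_LL_mul (hm : 1 ≤ m) (hα : α.det = m) (r s : ℤ) (z : ℍ) :
    heckeTerm m (r - 1) (s - 1) (fun w => LL w * f w) α z =
      (m : ℂ)⁻¹ * LL z * heckeTerm m r s f α z := by
  rw [heckeTerm_eq, heckeTerm_eq]
  simp only [LL_moebius hm hα]
  have hJ := moebius_denom_ne_zero hm hα z
  have hJb := moebius_denom_conj_ne_zero hm hα z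
  have hm0 : (m : ℂ) ≠ 0 := by
    have : m ≠ 0 := by omega
    exact_mod_cast this
  rw [show r - 1 + (s - 1) - 1 = (r + s - 1) - 2 by ring, show -(r - 1) = -r + 1 by ring,
    show -(s - 1) = -s + 1 by ring, zpow_add_one₀ hJb, zpow_add_one₀ hJ, zpow_sub₀ hm0]
  field_simp

/-- The factor of automorphy is multiplicative. -/
lemma moebius_denom_mul {β : Matrix (Fin 2) (Fin 2) ℤ} (hm : 1 ≤ m) (hβ : β.det = m) (z : ℍ) :
    ((α * β) 1 0 : ℂ) * z + ((α * β) 1 1 : ℂ) =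
      ((α 1 0 : ℂ) * moebius β z + (α 1 1 : ℂ)) * ((β 1 0 : ℂ) * z + (β 1 1 : ℂ)) := by
  have hJ := moebius_denom_ne_zero hm hβ z
  rw [coe_moebius hm hβ, Matrix.mul_apply, Matrix.mul_apply]
  simp only [Fin.sum_univ_two, Int.cast_add, Int.cast_mul]
  field_simp
  ring

lemma moebius_num_mul {β : Matrix (Fin 2) (Fin 2) ℤ} (hm : 1 ≤ m) (hβ : β.det = m) (z : ℍ) :
    ((α * β) 0 0 : ℂ) * z + ((α * β) 0 1 : ℂ) =
      ((α 0 0 : ℂ) * moebius β z + (α 0 1 : ℂ)) * ((β 1 0 : ℂ) * z + (β 1 1 : ℂ)) := by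
  have hJ := moebius_denom_ne_zero hm hβ z
  rw [coe_moebius hm hβ, Matrix.mul_apply, Matrix.mul_apply]
  simp only [Fin.sum_univ_two, Int.cast_add, Int.cast_mul]
  field_simp
  ring

lemma moebius_denom_conj_mul {β : Matrix (Fin 2) (Fin 2) ℤ} (hm : 1 ≤ m) (hβ : β.det = m)
    (z : ℍ) :
    ((α * β) 1 0 : ℂ) * conj (z : ℂ) + ((α * β) 1 1 : ℂ) =
      ((α 1 0 : ℂ) * conj (moebius β z : ℂ) + (α 1 1 : ℂ)) *
        ((β 1 0 : ℂ) * conj (z : ℂ) + (β 1 1 : ℂ)) := by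
  rw [moebius_denom_conj, moebius_denom_mul hm hβ, map_mul, ← moebius_denom_conj,
    ← moebius_denom_conj]

lemma moebius_mul {β : Matrix (Fin 2) (Fin 2) ℤ} (hm : 1 ≤ m) (hβ : β.det = m) (z : ℍ) :
    moebius (α * β) z = moebius α (moebius β z) := by
  rw [moebius, moebius_denom_mul hm hβ, moebius_num_mul hm hβ,
    mul_div_mul_right _ _ (moebius_denom_ne_zero hm hβ z), ← moebius]

lemma det_coe_eq_one (γ : SL(2, ℤ)) : (γ : Matrix (Fin 2) (Fin 2) ℤ).det = (1 : ℕ) := by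
  simp

lemma moebius_coe (γ : SL(2, ℤ)) (z : ℍ) : moebius γ z = γ • z := by
  apply UpperHalfPlane.ext
  rw [coe_moebius le_rfl (det_coe_eq_one γ), UpperHalfPlane.coe_specialLinearGroup_apply]
  simp

lemma heckeTerm_coe_mul {r s : ℤ} (hf : IsModular r s f) (hm : 1 ≤ m) (hα : α.det = m)
    (γ : SL(2, ℤ)) (z : ℍ) :
    heckeTerm m r s f (γ * α) z = heckeTerm m r s f α z := by
  rw [heckeTerm_eq, heckeTerm_eq]
  simp only [moebius_denom_mul hm hα, moebius_denom_conj_mul hm hα, moebius_mul hm hα, moebius_coe,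
    hf γ, mul_zpow]
  have hJ := moebius_denom_ne_zero le_rfl (det_coe_eq_one γ) (moebius α z)
  have hK := moebius_denom_conj_ne_zero le_rfl (det_coe_eq_one γ) (moebius α z)
  have h1 := zpow_ne_zero r hJ
  have h2 := zpow_ne_zero s hK
  simp only [zpow_neg _ r, zpow_neg _ s]
  field_simp

lemma heckeTerm_smul (r s : ℤ) (f : ℍ → ℂ) (α : Matrix (Fin 2) (Fin 2) ℤ) (γ : SL(2, ℤ)) (z : ℍ) :
    heckeTerm m r s f α (γ • z) = ((γ 1 0 : ℂ) * z + (γ 1 1 : ℂ)) ^ r *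
      ((γ 1 0 : ℂ) * conj (z : ℂ) + (γ 1 1 : ℂ)) ^ s * heckeTerm m r s f (α * γ) z := by
  have hγ := det_coe_eq_one γ
  rw [heckeTerm_eq, heckeTerm_eq]
  simp only [moebius_denom_mul le_rfl hγ, moebius_denom_conj_mul le_rfl hγ, moebius_mul le_rfl hγ,
    moebius_coe, mul_zpow]
  have hJ := moebius_denom_ne_zero le_rfl hγ z
  have hK := moebius_denom_conj_ne_zero le_rfl hγ z
  have h1 := zpow_ne_zero r hJ
  have h2 := zpow_ne_zero s hK
  simp only [zpow_neg _ r, zpow_neg _ s]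
  field_simp

/-- A triangular matrix acts by an affine map fixing the cusp `i∞`, with `Im (αz) = (m/d²) Im z ≤ m
Im z`, and its automorphy factors are constant. -/
lemma hasExpGrowth_heckeTerm_of_upper (hm : 1 ≤ m) (hα : α.det = m) (hc : α 1 0 = 0)
    (hf : HasExpGrowth f) (r s : ℤ) : HasExpGrowth (heckeTerm m r s f α) := by
  rw [heckeTerm_eq]
  simp only [hc, Int.cast_zero, zero_mul, zero_add]
  have hd0 : (α 1 1) ≠ 0 := by
    rw [Matrix.det_fin_two, hc] at hα
    rintro h
    rw [h] at hα
    simp only [mul_zero, sub_zero] at hα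
    omega
  have hd1 : (1 : ℝ) ≤ (α 1 1 : ℝ) * α 1 1 := by
    have h : (1 : ℤ) ≤ α 1 1 * α 1 1 := by
      have := mul_self_pos.mpr hd0
      omega
    exact_mod_cast h
  have him : ∀ z, (moebius α z).im = m / ((α 1 1 : ℝ) * α 1 1) * z.im := fun z => by
    rw [im_moebius hm hα, hc]
    simp only [Int.cast_zero, zero_mul, zero_add, Complex.normSq_intCast]
    ring
  have hm0 : (0 : ℝ) < m := by exact_mod_cast hm
  refine ((hf.comp (α := moebius α) ?_ m fun z => ?_).const_mul _).const_mul _ |>.const_mul _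
  · rw [atImInfty, Filter.tendsto_comap_iff, Function.comp_def]
    simp only [him]
    exact Filter.tendsto_comap.const_mul_atTop (by positivity)
  · rw [him]
    have := z.im_pos
    gcongr
    exact div_le_self hm0.le hd1

end HeckeTerm

/-! ### Hecke operators as finite sums over cosets. -/

section Hecke

variable {m : ℕ} {f : ℍ → ℂ} {r s : ℤ}

/-- Used twice: for finiteness of the set of cosets, and to replace representatives by upper
triangular ones when estimating at the cusp. -/
lemma exists_smul_mem_reps {m : ℤ} (hm : m ≠ 0) (A : FixedDetMatrix (Fin 2) ℤ m) :
    ∃ γ : SL(2, ℤ), γ • A ∈ FixedDetMatrices.reps m := by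
  induction A using FixedDetMatrices.induction_on hm with
  | h0 A h1 h2 h3 h4 => exact ⟨1, by rw [one_smul]; exact ⟨h1, h2, h3, h4⟩⟩
  | hS B hB =>
    obtain ⟨γ, hγ⟩ := hB
    exact ⟨γ * ModularGroup.S⁻¹, by rwa [mul_smul, inv_smul_smul]⟩
  | hT B hB =>
    obtain ⟨γ, hγ⟩ := hB
    exact ⟨γ * ModularGroup.T⁻¹, by rwa [mul_smul, inv_smul_smul]⟩

/-- The cosets `SL₂(ℤ) \ {α ∈ M₂(ℤ) : det α = m}`. -/
abbrev HeckeCoset (m : ℕ) :=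
  MulAction.orbitRel.Quotient SL(2, ℤ) (FixedDetMatrix (Fin 2) ℤ (m : ℤ))

lemma finite_heckeCoset (hm : 1 ≤ m) : Finite (HeckeCoset m) := by
  refine Finite.of_surjective
    (fun A : FixedDetMatrices.reps (m : ℤ) => (Quotient.mk _ A.1 : HeckeCoset m)) ?_
  intro c
  induction c using Quotient.inductionOn with
  | h A =>
    obtain ⟨γ, hγ⟩ := exists_smul_mem_reps (by omega) A
    exact ⟨⟨γ • A, hγ⟩, Quotient.sound (MulAction.mem_orbit A γ)⟩

lemma hecke_eq_sum [Fintype (HeckeCoset m)] (r s : ℤ) (f : ℍ → ℂ) :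
    hecke m r s f = fun z => ∑ c : HeckeCoset m, heckeTerm m r s f (Quotient.out c).1 z := by
  funext z
  rw [hecke, finsum_eq_sum_of_fintype]

lemma IsSmooth.hecke (hm : 1 ≤ m) (hf : IsSmooth f) (r s : ℤ) : IsSmooth (hecke m r s f) := by
  have := finite_heckeCoset hm
  have := Fintype.ofFinite (HeckeCoset m)
  rw [hecke_eq_sum]
  exact .sum _ fun c _ => hf.heckeTerm hm (Quotient.out c).2 r s

lemma del_hecke (hm : 1 ≤ m) (hf : IsSmooth f) (r s : ℤ) :
    del r (hecke m r s f) = hecke m (r + 1) (s - 1) (del r f) := by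
  have := finite_heckeCoset hm
  have := Fintype.ofFinite (HeckeCoset m)
  rw [hecke_eq_sum, hecke_eq_sum]
  funext z
  rw [(HasWirtingerAt.sum Finset.univ fun c _ =>
    (hf.heckeTerm hm (Quotient.out c).2 r s).hasWirtingerAt z).del_eq]
  rw [Finset.mul_sum, Finset.mul_sum, ← Finset.sum_add_distrib]
  refine Finset.sum_congr rfl fun c _ => ?_
  rw [← del_heckeTerm hm (Quotient.out c).2 hf, del]

lemma conjFun_hecke (hm : 1 ≤ m) (r s : ℤ) (f : ℍ → ℂ) :
    conjFun (hecke m r s f) = hecke m s r (conjFun f) := by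
  have := finite_heckeCoset hm
  have := Fintype.ofFinite (HeckeCoset m)
  rw [hecke_eq_sum, hecke_eq_sum]
  funext z
  simp only [conjFun, map_sum]
  refine Finset.sum_congr rfl fun c _ => ?_
  exact congrFun (conjFun_heckeTerm m r s f (Quotient.out c).1) z

lemma delBar_hecke (hm : 1 ≤ m) (hf : IsSmooth f) (r s : ℤ) :
    delBar s (hecke m r s f) = hecke m (r - 1) (s + 1) (delBar s f) := by
  rw [(hf.hecke hm r s).delBar_eq_conjFun, conjFun_hecke hm, del_hecke hm hf.conjFun,
    conjFun_hecke hm, ← hf.delBar_eq_conjFun]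

lemma hecke_LL_mul (hm : 1 ≤ m) (r s : ℤ) (f : ℍ → ℂ) (z : ℍ) :
    hecke m (r - 1) (s - 1) (fun w => LL w * f w) z = (m : ℂ)⁻¹ * LL z * hecke m r s f z := by
  have := finite_heckeCoset hm
  have := Fintype.ofFinite (HeckeCoset m)
  rw [hecke_eq_sum, hecke_eq_sum, Finset.mul_sum]
  exact Finset.sum_congr rfl fun c _ => heckeTerm_LL_mul hm (Quotient.out c).2 r s z

lemma hecke_const_mul (hm : 1 ≤ m) (r s : ℤ) (f : ℍ → ℂ) (a : ℂ) (z : ℍ) :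
    hecke m r s (fun w => a * f w) z = a * hecke m r s f z := by
  have := finite_heckeCoset hm
  have := Fintype.ofFinite (HeckeCoset m)
  rw [hecke_eq_sum, hecke_eq_sum, Finset.mul_sum]
  refine Finset.sum_congr rfl fun c _ => ?_
  rw [heckeTerm, heckeTerm]
  ring

lemma HasExpGrowth.hecke (hm : 1 ≤ m) (hf : HasExpGrowth f) (hmod : IsModular r s f) :
    HasExpGrowth (hecke m r s f) := by
  have := finite_heckeCoset hm
  have := Fintype.ofFinite (HeckeCoset m)
  rw [hecke_eq_sum]
  refine .sum _ fun c _ => ?_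
  -- The chosen representative need not fix the cusp; by modularity of `f` a triangular one gives
  -- the same summand.
  obtain ⟨γ, hγ⟩ := exists_smul_mem_reps (by omega) (Quotient.out c)
  have h := hasExpGrowth_heckeTerm_of_upper hm (γ • Quotient.out c).2 hγ.1 hf r s
  rwa [FixedDetMatrices.smul_coe, funext (heckeTerm_coe_mul hmod hm (Quotient.out c).2 γ)] at h

/-- Right multiplication by `SL₂(ℤ)` on integral matrices of fixed determinant. -/
def mulRightEquiv (m : ℤ) (γ : SL(2, ℤ)) :
    FixedDetMatrix (Fin 2) ℤ m ≃ FixedDetMatrix (Fin 2) ℤ m where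
  toFun A := ⟨A.1 * γ, by simp [A.2]⟩
  invFun A := ⟨A.1 * (γ⁻¹ : SL(2, ℤ)), by
    rw [Matrix.det_mul, A.2, Matrix.SpecialLinearGroup.det_coe, mul_one]⟩
  left_inv A := FixedDetMatrices.ext' _ _ (by
    simp only [Matrix.mul_assoc, ← Matrix.SpecialLinearGroup.coe_mul]
    simp)
  right_inv A := FixedDetMatrices.ext' _ _ (by
    simp only [Matrix.mul_assoc, ← Matrix.SpecialLinearGroup.coe_mul]
    simp)

lemma smul_mulRightEquiv (m : ℤ) (γ δ : SL(2, ℤ)) (A : FixedDetMatrix (Fin 2) ℤ m) :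
    mulRightEquiv m γ (δ • A) = δ • mulRightEquiv m γ A :=
  FixedDetMatrices.ext' _ _ (Matrix.mul_assoc δ.1 A.1 γ.1)

/-- Right multiplication by `SL₂(ℤ)` permutes the cosets. -/
def heckeCosetEquiv (m : ℕ) (γ : SL(2, ℤ)) : HeckeCoset m ≃ HeckeCoset m :=
  Quotient.congr (mulRightEquiv m γ) fun A B => by
    rw [MulAction.orbitRel_apply, MulAction.orbitRel_apply]
    constructor
    · rintro ⟨δ, rfl⟩
      exact ⟨δ, (smul_mulRightEquiv _ _ _ _).symm⟩
    · rintro ⟨δ, h⟩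
      refine ⟨δ, (mulRightEquiv (m : ℤ) γ).injective ?_⟩
      rw [← h]
      exact smul_mulRightEquiv _ _ _ _

/-- Acting by `γ` replaces `α` by `αγ` up to the automorphy factor. The summands descend to
functions of the coset, and right multiplication by `γ` only permutes the cosets. -/
lemma IsModular.hecke (hm : 1 ≤ m) (hmod : IsModular r s f) : IsModular r s (hecke m r s f) := by
  have := finite_heckeCoset hm
  have := Fintype.ofFinite (HeckeCoset m)
  intro γ z
  rw [hecke_eq_sum]
  simp only [heckeTerm_smul]
  rw [← Finset.mul_sum]
  congr 1
  have hinv : ∀ A B : FixedDetMatrix (Fin 2) ℤ (m : ℤ),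
      (MulAction.orbitRel SL(2, ℤ) (FixedDetMatrix (Fin 2) ℤ (m : ℤ))) A B →
      heckeTerm m r s f A.1 z = heckeTerm m r s f B.1 z := by
    rintro A B ⟨δ, rfl⟩
    exact heckeTerm_coe_mul hmod hm B.2 δ z
  set G : HeckeCoset m → ℂ :=
    Quotient.lift (fun A : FixedDetMatrix (Fin 2) ℤ (m : ℤ) => heckeTerm m r s f A.1 z) hinv
  have hG : ∀ c : HeckeCoset m, heckeTerm m r s f (Quotient.out c).1 z = G c := by
    intro c
    conv_rhs => rw [← Quotient.out_eq c]
    rfl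
  have hG2 : ∀ c : HeckeCoset m,
      heckeTerm m r s f ((Quotient.out c).1 * γ) z = G (heckeCosetEquiv m γ c) := by
    intro c
    conv_rhs => rw [← Quotient.out_eq c]
    rfl
  simp only [hG, hG2]
  exact Equiv.sum_comp (heckeCosetEquiv m γ) G

end Hecke

/-! ### Modularity -/

section Modular

variable {f g : ℍ → ℂ} {r s : ℤ}

lemma IsModular.sub (hf : IsModular r s f) (hg : IsModular r s g) :
    IsModular r s (fun z => f z - g z) := fun γ z => by
  simp only [hf γ z, hg γ z]; ring

lemma IsModular.const_mul (hf : IsModular r s f) (c : ℂ) :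
    IsModular r s (fun z => c * f z) := fun γ z => by
  simp only [hf γ z]; ring

lemma IsModular.conjFun (hf : IsModular r s f) : IsModular s r (conjFun f) := fun γ z => by
  simp only [NonHolModular.conjFun, hf γ z, map_mul, map_zpow₀, map_add, map_intCast,
    Complex.conj_conj]
  ring

lemma IsModular.LL_zpow_mul (hf : IsModular r s f) (k : ℤ) :
    IsModular (r - k) (s - k) (fun z => LL z ^ k * f z) := fun γ z => by
  have hγ := det_coe_eq_one γ
  have hJ := moebius_denom_ne_zero le_rfl hγ z
  have hK := moebius_denom_conj_ne_zero le_rfl hγ z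
  simp only [hf γ z]
  rw [← moebius_coe, LL_moebius le_rfl hγ, div_zpow, mul_zpow, mul_zpow, zpow_sub₀ hJ,
    zpow_sub₀ hK]
  simp only [Nat.cast_one, one_zpow, one_mul]
  field_simp

/-- For `m = 1` the Hecke summand is the slash action, so modularity of `∂f` becomes a case of
`del_heckeTerm`. -/
lemma isModular_iff_heckeTerm :
    IsModular r s f ↔ ∀ γ : SL(2, ℤ), heckeTerm 1 r s f γ = f := by
  refine forall_congr' fun γ => ?_
  rw [funext_iff]
  refine forall_congr' fun z => ?_
  have h1 := zpow_ne_zero r (moebius_denom_ne_zero le_rfl (det_coe_eq_one γ) z)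
  have h2 := zpow_ne_zero s (moebius_denom_conj_ne_zero le_rfl (det_coe_eq_one γ) z)
  rw [heckeTerm_eq]
  simp only [moebius_coe, Nat.cast_one, one_zpow, one_mul, zpow_neg]
  rw [inv_mul_eq_iff_eq_mul₀ h1, inv_mul_eq_iff_eq_mul₀ h2, mul_left_comm, mul_assoc,
    mul_left_comm]

lemma IsModular.del (hf : IsModular r s f) (hs : IsSmooth f) :
    IsModular (r + 1) (s - 1) (del r f) := by
  rw [isModular_iff_heckeTerm] at hf ⊢
  intro γ
  rw [← del_heckeTerm le_rfl (det_coe_eq_one γ) hs, hf γ]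

lemma IsModular.delPow (hf : IsModular r s f) (hs : IsSmooth f) (k : ℕ) :
    IsModular (r + k) (s - k) (delPow r k f) := by
  induction k with
  | zero => simpa [NonHolModular.delPow] using hf
  | succ k ih =>
    have h := ih.del (hs.delPow r k)
    rw [NonHolModular.delPow]
    convert h using 1 <;> push_cast <;> ring

lemma IsWeaklyHolomorphic.const_mul (hf : IsWeaklyHolomorphic r f) (c : ℂ) :
    IsWeaklyHolomorphic r (fun z => c * f z) :=
  isWeaklyHolomorphic_of_hasExpGrowth (hf.holo.const_smul c) (hf.modular.const_mul c)
    (hf.hasExpGrowth.const_mul c)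

lemma normalizedDeriv_iterate_const_mul (hf : MDifferentiable 𝓘(ℂ) 𝓘(ℂ) f) (c : ℂ) (k : ℕ) :
    Derivative.normalizedDerivOfComplex^[k] (fun z => c * f z) =
      fun z => c * (Derivative.normalizedDerivOfComplex^[k] f) z := by
  induction k with
  | zero => rfl
  | succ k ih =>
    rw [Function.iterate_succ_apply', ih, Function.iterate_succ_apply']
    exact Derivative.normalizedDerivOfComplex_smul c _
      (normalizedDeriv_iterate_mdifferentiable hf k)

lemma LL_zpow_mul_delPow_eq (hf : MDifferentiable 𝓘(ℂ) 𝓘(ℂ) f) (n : ℕ) (z : ℍ) :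
    1 / (n.factorial : ℂ) * LL z ^ (-(n : ℤ) - 1) * delPow (-n) (n + 1) f z =
      2 ^ (n + 1) / (n.factorial : ℂ) * (Derivative.normalizedDerivOfComplex^[n + 1] f) z := by
  have h := delPow_bol hf (n + 1) z
  rw [show (1 - ((n + 1 : ℕ) : ℤ)) = -n by push_cast; ring] at h
  rw [h, show (-(n : ℤ) - 1) = -((n + 1 : ℕ) : ℤ) by push_cast; ring, zpow_neg, zpow_natCast,
    mul_pow]
  have := pow_ne_zero (n + 1) (LL_ne_zero z)
  field_simp

/-- By Bol's identity, `D ^ (n + 1) M^!_{-n}` is the image of `M^!_{-n}` under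
`(n!)⁻¹ 𝕃 ^ (-n - 1) ∂ ^ (n + 1)`. -/
lemma exists_normalizedDeriv_iff (n : ℕ) (F : ℍ → ℂ) :
    (∃ ξ : ℍ → ℂ, IsWeaklyHolomorphic (-n) ξ ∧
      ∀ z, F z = (Derivative.normalizedDerivOfComplex^[n + 1] ξ) z) ↔
    ∃ ψ : ℍ → ℂ, IsWeaklyHolomorphic (-n) ψ ∧
      ∀ z, F z = 1 / (n.factorial : ℂ) * LL z ^ (-(n : ℤ) - 1) * delPow (-n) (n + 1) ψ z := by
  have hn : (n.factorial : ℂ) ≠ 0 := by exact_mod_cast n.factorial_ne_zero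
  constructor
  · rintro ⟨ξ, hξ, h⟩
    have hψ := hξ.const_mul ((n.factorial : ℂ) / 2 ^ (n + 1))
    refine ⟨_, hψ, fun z => ?_⟩
    rw [LL_zpow_mul_delPow_eq hψ.holo, normalizedDeriv_iterate_const_mul hξ.holo, h]
    field_simp
  · rintro ⟨ψ, hψ, h⟩
    refine ⟨_, hψ.const_mul (2 ^ (n + 1) / (n.factorial : ℂ)), fun z => ?_⟩
    rw [normalizedDeriv_iterate_const_mul hψ.holo, h, LL_zpow_mul_delPow_eq hψ.holo]

end Modular

/-! ### Primitive families -/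

/-- The properties of a primitive family that are used below. -/
structure IsSmoothFamily (n : ℕ) (f g : ℍ → ℂ) (X : ℕ → ℕ → ℍ → ℂ) : Prop where
  f_mem : IsWeaklyHolomorphic (n + 2) f
  g_mem : IsWeaklyHolomorphic (n + 2) g
  smooth : ∀ r s : ℕ, r + s = n → IsSmooth (X r s)
  modular : ∀ r s : ℕ, r + s = n → IsModular r s (X r s)
  growth : ∀ r s : ℕ, r + s = n → HasExpGrowth (X r s)
  del_top : del n (X n 0) = fun z => LL z * f z
  del_eq : ∀ r s : ℕ, r + (s + 1) = n →
    del r (X r (s + 1)) = fun z => (r + 1) * X (r + 1) s z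
  delBar_eq : ∀ r s : ℕ, (r + 1) + s = n →
    delBar s (X (r + 1) s) = fun z => (s + 1) * X r (s + 1) z
  delBar_bot : delBar n (X 0 n) = fun z => LL z * conj (g z)

lemma IsPrimitiveFamily.isSmoothFamily {n : ℕ} {f g : ℍ → ℂ} {X : ℕ → ℕ → ℍ → ℂ}
    (hX : IsPrimitiveFamily n f g X) : IsSmoothFamily n f g X where
  f_mem := hX.f_mem
  g_mem := hX.g_mem
  smooth r s h := (hX.X_mem r s h).isSmooth
  modular r s h := (hX.X_mem r s h).modular
  growth r s h := (hX.X_mem r s h).hasExpGrowth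
  del_top := funext hX.del_top
  del_eq r s h := funext (hX.del_eq r s h)
  delBar_eq r s h := funext (hX.delBar_eq r s h)
  delBar_bot := funext hX.delBar_bot

namespace IsSmoothFamily

variable {n : ℕ} {f g : ℍ → ℂ} {X : ℕ → ℕ → ℍ → ℂ}

/-- Complex conjugation exchanges the two ends of a family. -/
lemma swap (hX : IsSmoothFamily n f g X) :
    IsSmoothFamily n g f (fun r s => conjFun (X s r)) where
  f_mem := hX.g_mem
  g_mem := hX.f_mem
  smooth r s h := (hX.smooth s r (by omega)).conjFun
  modular r s h := (hX.modular s r (by omega)).conjFun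
  growth r s h := (hX.growth s r (by omega)).conjFun
  del_top := by
    rw [← (hX.smooth 0 n (by omega)).conjFun_delBar, hX.delBar_bot]
    funext z
    simp [conjFun, conj_LL]
  del_eq r s h := by
    rw [← (hX.smooth (s + 1) r (by omega)).conjFun_delBar, hX.delBar_eq s r (by omega)]
    funext z
    simp [conjFun]
  delBar_eq r s h := by
    rw [← (hX.smooth s (r + 1) (by omega)).conjFun_del, hX.del_eq s r (by omega)]
    funext z
    simp [conjFun]
  delBar_bot := by
    rw [← (hX.smooth n 0 (by omega)).conjFun_del, hX.del_top]
    funext z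
    simp [conjFun, conj_LL]

/-- The defect `m T_m X_{r,s} - lam X_{r,s}`. -/
def defect (X : ℕ → ℕ → ℍ → ℂ) (m : ℕ) (lam : ℂ) (r s : ℕ) (z : ℍ) : ℂ :=
  m * hecke m r s (X r s) z - lam * X r s z

variable {m : ℕ}

lemma defect_smooth (hX : IsSmoothFamily n f g X) (hm : 1 ≤ m) (lam : ℂ) {r s : ℕ}
    (h : r + s = n) : IsSmooth (defect X m lam r s) :=
  (((hX.smooth r s h).hecke hm r s).const_mul m).sub ((hX.smooth r s h).const_mul lam)

lemma defect_modular (hX : IsSmoothFamily n f g X) (hm : 1 ≤ m) (lam : ℂ) {r s : ℕ}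
    (h : r + s = n) : IsModular r s (defect X m lam r s) :=
  (((hX.modular r s h).hecke hm).const_mul m).sub ((hX.modular r s h).const_mul lam)

lemma defect_growth (hX : IsSmoothFamily n f g X) (hm : 1 ≤ m) (lam : ℂ) {r s : ℕ}
    (h : r + s = n) : HasExpGrowth (defect X m lam r s) :=
  (((hX.growth r s h).hecke hm (hX.modular r s h)).const_mul m).sub
    ((hX.growth r s h).const_mul lam)

/-- The factor `m` in `defect` cancels the `m⁻¹` of `hecke_LL_mul`. -/
lemma del_defect_top (hX : IsSmoothFamily n f g X) (hm : 1 ≤ m) (lam : ℂ) (z : ℍ) :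
    del n (defect X m lam n 0) z = LL z * (hecke m (n + 2) 0 f z - lam * f z) := by
  have hs := hX.smooth n 0 (by omega)
  have hm0 : (m : ℂ) ≠ 0 := by exact_mod_cast (by omega : m ≠ 0)
  have h1 : del n (defect X m lam n 0) = _ :=
    del_sub ((hs.hecke hm n (0 : ℕ)).const_mul m) (hs.const_mul lam) n
  have h2 := hecke_LL_mul hm ((n : ℤ) + 2) 0 f z
  rw [h1, del_const_mul (hs.hecke hm _ _), del_const_mul hs, del_hecke hm hs, hX.del_top]
  rw [show (n : ℤ) + 2 - 1 = n + 1 by ring] at h2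
  simp only [Nat.cast_zero, h2]
  field_simp

lemma delBar_defect (hX : IsSmoothFamily n f g X) (hm : 1 ≤ m) (lam : ℂ) {r s : ℕ}
    (h : r + 1 + s = n) (z : ℍ) :
    delBar s (defect X m lam (r + 1) s) z = (s + 1) * defect X m lam r (s + 1) z := by
  have hs := hX.smooth (r + 1) s h
  have h1 : delBar s (defect X m lam (r + 1) s) = _ :=
    delBar_sub ((hs.hecke hm (r + 1 : ℕ) s).const_mul m) (hs.const_mul lam) s
  rw [h1, delBar_const_mul (hs.hecke hm _ _), delBar_const_mul hs, delBar_hecke hm hs,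
    hX.delBar_eq r s h, defect]
  simp only [hecke_const_mul hm]
  push_cast
  rw [add_sub_cancel_right]
  ring

lemma delBar_defect_bot (hX : IsSmoothFamily n f g X) (hm : 1 ≤ m) (lam : ℂ) (z : ℍ) :
    delBar n (defect X m lam 0 n) z =
      LL z * conj (hecke m (n + 2) 0 g z - conj lam * g z) := by
  have hs := hX.smooth 0 n (by omega)
  have hm0 : (m : ℂ) ≠ 0 := by exact_mod_cast (by omega : m ≠ 0)
  have h1 : delBar n (defect X m lam 0 n) = _ :=
    delBar_sub ((hs.hecke hm (0 : ℕ) n).const_mul m) (hs.const_mul lam) n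
  have h2 := hecke_LL_mul hm 0 ((n : ℤ) + 2) (conjFun g) z
  rw [h1, delBar_const_mul (hs.hecke hm _ _), delBar_const_mul hs, delBar_hecke hm hs,
    hX.delBar_bot]
  rw [show (n : ℤ) + 2 - 1 = n + 1 by ring, ← conjFun_hecke hm] at h2
  simp only [conjFun] at h2
  simp only [Nat.cast_zero, h2, map_sub, map_mul, Complex.conj_conj]
  field_simp

/-- If `(T_m - lam) f` comes from `ψ`, then `(T_m - conj lam) g` comes from some `φ`, and the
two determine `(T_m - lam / m) X_{r,s}`. -/
theorem exists_companion (hX : IsSmoothFamily n f g X) (hm : 1 ≤ m) (lam : ℂ) {ψ : ℍ → ℂ}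
    (hψ : IsWeaklyHolomorphic (-n) ψ)
    (hf : ∀ z, hecke m (n + 2) 0 f z - lam * f z =
      1 / (n.factorial : ℂ) * LL z ^ (-(n : ℤ) - 1) * delPow (-n) (n + 1) ψ z) :
    ∃ φ : ℍ → ℂ, IsWeaklyHolomorphic (-n) φ ∧
      (∀ z, hecke m (n + 2) 0 g z - conj lam * g z =
        1 / (n.factorial : ℂ) * LL z ^ (-(n : ℤ) - 1) * delPow (-n) (n + 1) φ z) ∧
      ∀ r s : ℕ, r + s = n → ∀ z,
        hecke m r s (X r s) z - lam / m * X r s z =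
          1 / (m : ℂ) * LL z ^ (-(n : ℤ)) *
            (delPow (-n) r ψ z / (r.factorial : ℂ) +
              delBarPow (-n) s (conjFun φ) z / (s.factorial : ℂ)) := by
  have hm0 : (m : ℂ) ≠ 0 := by exact_mod_cast (by omega : m ≠ 0)
  have hψs : IsSmooth ψ := .of_mdifferentiable hψ.holo
  have hLs : ∀ k : ℤ, IsSmooth (fun z => LL z ^ k) := isSmooth_LL.zpow LL_ne_zero
  -- The contribution of `ψ`: `∂^r ψ` has weights `(r - n, -r)`, and `𝕃^{-n}` shifts them to `(r, n
  -- - r)`.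
  set E : ℕ → ℍ → ℂ := fun r z => LL z ^ (-(n : ℤ)) * (1 / (r.factorial : ℂ) * delPow (-n) r ψ z)
    with hE
  have hEin : ∀ r : ℕ, IsSmooth fun z => 1 / (r.factorial : ℂ) * delPow (-n) r ψ z :=
    fun r => (hψs.delPow _ r).const_mul _
  have hEs : ∀ r, IsSmooth (E r) := fun r => (hLs _).mul (hEin r)
  set Z : ℕ → ℕ → ℍ → ℂ := fun r s z => defect X m lam r s z - E r z with hZ
  have hZs : ∀ r s, r + s = n → IsSmooth (Z r s) := fun r s h =>
    (hX.defect_smooth hm lam h).sub (hEs r)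
  -- Past `𝕃^{-n}` the operator `∂_n` acts as `∂_0`, the last factor of `∂^{n+1}` in starting weight
  -- `-n`. So `E n` and the defect have the same image under `∂`.
  have hZtop : ∀ z, del n (Z n 0) z = 0 := by
    intro z
    have h1 : del n (Z n 0) = _ := del_sub (hX.defect_smooth hm lam (add_zero n)) (hEs n) n
    have h2 : del n (E n) = _ := del_LL_zpow_mul (hEin n) (-(n : ℤ)) n
    rw [h1, h2, del_const_mul (hψs.delPow _ n)]
    simp only [hX.del_defect_top hm lam z, hf z]
    rw [delPow, zpow_sub_one₀ (LL_ne_zero z), add_comm (n : ℤ)]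
    field_simp [LL_ne_zero z]
    ring
  have hZstep : ∀ r s : ℕ, r + 1 + s = n → ∀ z,
      delBar s (Z (r + 1) s) z = (s + 1) * Z r (s + 1) z := by
    intro r s h z
    have h1 : delBar s (Z (r + 1) s) = _ :=
      delBar_sub (hX.defect_smooth hm lam h) (hEs (r + 1)) s
    have h2 : delBar s (E (r + 1)) = _ := delBar_LL_zpow_mul (hEin (r + 1)) (-(n : ℤ)) s
    rw [h1, h2, delBar_const_mul (hψs.delPow _ (r + 1))]
    have h3 := delBar_delPow_succ hψ.holo n r z
    have hns : (n : ℤ) = r + 1 + s := by exact_mod_cast h.symm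
    have hns' : ((n : ℤ) : ℂ) = r + 1 + s := by exact_mod_cast h.symm
    have hr : ((r + 1).factorial : ℂ) = (r + 1) * r.factorial := by
      exact_mod_cast Nat.factorial_succ r
    have hr0 : (r.factorial : ℂ) ≠ 0 := by exact_mod_cast r.factorial_ne_zero
    have hr1 : (r + 1 : ℂ) ≠ 0 := by exact_mod_cast r.succ_ne_zero
    simp only [hX.delBar_defect hm lam h z, hZ, hE]
    -- The constants match because `(r + 1)(n - r)/(r + 1)! = (s + 1)/r!` when `n = r + 1 + s`.
    rw [show (s : ℤ) + -(n : ℤ) = -(r + 1) by omega, h3, hns', hr]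
    field_simp
    ring
  -- `E 0 = 𝕃^{-n} ψ` contributes nothing: `∂̄_n` becomes `∂̄_0` on the holomorphic `ψ`.
  have hZbot : ∀ z, delBar n (Z 0 n) z =
      LL z * conj (hecke m (n + 2) 0 g z - conj lam * g z) := by
    intro z
    have h1 : delBar n (Z 0 n) = _ :=
      delBar_sub (hX.defect_smooth hm lam (zero_add n)) (hEs 0) n
    have h2 : delBar n (E 0) = _ := delBar_LL_zpow_mul (hEin 0) (-(n : ℤ)) n
    rw [h1, h2, delBar_const_mul (hψs.delPow _ 0)]
    simp only [hX.delBar_defect_bot hm lam z, add_neg_cancel, delPow,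
      delBar_zero_of_mdifferentiable hψ.holo, mul_zero, sub_zero]
  -- `Φ` has weights `(0, -n)` and is killed by `∂_0`, hence antiholomorphic; its conjugate is the
  -- required `φ`.
  set Φ : ℍ → ℂ := fun z => LL z ^ (n : ℤ) * Z n 0 z with hΦ
  have hΦs : IsSmooth Φ := (hLs _).mul (hZs n 0 (add_zero n))
  have hΦdel : ∀ z, del 0 Φ z = 0 := by
    intro z
    have h : del 0 Φ = _ := del_LL_zpow_mul (hZs n 0 (add_zero n)) n 0
    simp only [h, zero_add, hZtop, mul_zero]
  have hφhol : MDifferentiable 𝓘(ℂ) 𝓘(ℂ) (conjFun Φ) := by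
    refine mdifferentiable_of_wirtingerBar_eq_zero hΦs.conjFun fun z => ?_
    have h : delBar 0 (conjFun Φ) z = 0 := by
      rw [← hΦs.conjFun_del, conjFun, hΦdel, map_zero]
    rw [delBar, Int.cast_zero, zero_mul, add_zero, mul_eq_zero] at h
    refine h.resolve_left fun h0 => LL_ne_zero z ?_
    rw [LL_eq, ← neg_sub, h0]
    simp
  have hφmod : IsModular (-n) 0 (conjFun Φ) := by
    have h1 := ((hψ.modular.delPow hψs n).const_mul (1 / (n.factorial : ℂ))).LL_zpow_mul (-(n : ℤ))
    have h2 := hX.defect_modular hm lam (add_zero n)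
    simp only [neg_add_cancel, zero_sub, sub_neg_eq_add, zero_add] at h1
    have h4 : IsModular (n : ℤ) 0 (Z n 0) := IsModular.sub h2 h1
    have h5 : IsModular ((n : ℤ) - n) (0 - n) Φ := h4.LL_zpow_mul n
    rw [sub_self, zero_sub] at h5
    exact h5.conjFun
  have hφgrowth : HasExpGrowth (conjFun Φ) := by
    refine HasExpGrowth.conjFun ((HasExpGrowth.LL_zpow n).mul ?_)
    exact (hX.defect_growth hm lam (add_zero n)).sub ((HasExpGrowth.LL_zpow _).mul
      ((hψ.hasExpGrowth.delPow hψ.holo _ n).const_mul _))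
  -- The `∂̄`-ladder recovers every `Z r s` from `Z n 0 = 𝕃^{-n} Φ`, each step dividing by `s + 1`.
  have hZeq : ∀ s r : ℕ, r + s = n → Z r s = fun z =>
      LL z ^ (-(n : ℤ)) * (1 / (s.factorial : ℂ) * delBarPow (-n) s Φ z) := by
    intro s
    induction s with
    | zero =>
      intro r h
      obtain rfl : r = n := by omega
      funext z
      have := zpow_ne_zero (r : ℤ) (LL_ne_zero z)
      simp only [delBarPow, hΦ, zpow_neg, Nat.factorial_zero, Nat.cast_one, div_one, one_mul]
      field_simp
    | succ s ih =>
      intro r h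
      funext z
      have h1 := hZstep r s (by omega) z
      rw [ih (r + 1) (by omega),
        delBar_LL_zpow_mul ((hΦs.delBarPow _ s).const_mul _),
        delBar_const_mul (hΦs.delBarPow _ s)] at h1
      have hs : ((s + 1).factorial : ℂ) = (s + 1) * s.factorial := by
        exact_mod_cast Nat.factorial_succ s
      have hs0 : (s.factorial : ℂ) ≠ 0 := by exact_mod_cast s.factorial_ne_zero
      have hs1 : (s + 1 : ℂ) ≠ 0 := by exact_mod_cast s.succ_ne_zero
      rw [delBarPow, add_comm (-(n : ℤ)) s, hs]
      apply mul_left_cancel₀ hs1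
      rw [← h1]
      field_simp
  refine ⟨conjFun Φ, isWeaklyHolomorphic_of_hasExpGrowth hφhol hφmod hφgrowth, fun z => ?_, ?_⟩
  · have h1 := hZbot z
    rw [hZeq n 0 (zero_add n), delBar_LL_zpow_mul ((hΦs.delBarPow _ n).const_mul _),
      delBar_const_mul (hΦs.delBarPow _ n)] at h1
    have h2 := congrArg conj h1
    -- At the lower end `∂̄_n` past `𝕃^{-n}` supplies the last factor of `∂̄^{n+1} Φ`; conjugating
    -- gives `∂^{n+1} φ`.
    have h3 : conj (delBarPow (-n) (n + 1) Φ z) = delPow (-n) (n + 1) (conjFun Φ) z :=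
      congrFun (hΦs.conjFun_delBarPow (-n) (n + 1)) z
    rw [delBarPow, add_comm (-(n : ℤ)) n] at h3
    simp only [map_mul, map_zpow₀, conj_LL, h3, Complex.conj_conj, map_div₀, map_one,
      map_natCast] at h2
    apply mul_left_cancel₀ (LL_ne_zero z)
    rw [← h2, zpow_sub_one₀ (LL_ne_zero z)]
    field_simp [LL_ne_zero z]
  · intro r s h z
    have h1 := congrFun (hZeq s r h) z
    simp only [hZ, hE, defect] at h1
    rw [conjFun_conjFun]
    apply mul_left_cancel₀ hm0
    have h2 : (m : ℂ) * (hecke m r s (X r s) z - lam / m * X r s z) =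
        m * hecke m r s (X r s) z - lam * X r s z := by field_simp
    rw [h2, eq_add_of_sub_eq h1]
    field_simp
    ring

lemma isWeakHeckeEigenform_companion (hX : IsSmoothFamily n f g X) {lam : ℕ → ℂ}
    (hf : IsWeakHeckeEigenform n f lam) :
    IsWeakHeckeEigenform n g (fun m => conj (lam m)) := by
  refine ⟨hX.g_mem, fun m hm => ?_⟩
  obtain ⟨ψ, hψ, h⟩ := (exists_normalizedDeriv_iff n _).mp (hf.2 m hm)
  obtain ⟨φ, hφ, h', -⟩ := hX.exists_companion hm (lam m) hψ h
  exact (exists_normalizedDeriv_iff n _).mpr ⟨φ, hφ, h'⟩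

end IsSmoothFamily

lemma isWeakHeckeEigenform_congr {n : ℕ} {f : ℍ → ℂ} {lam mu : ℕ → ℂ}
    (h : ∀ m, 1 ≤ m → lam m = mu m) :
    IsWeakHeckeEigenform n f lam ↔ IsWeakHeckeEigenform n f mu := by
  refine and_congr_right fun _ => forall₂_congr fun m hm => ?_
  rw [h m hm]

end NonHolModular

end

theorem mainTheorem7 (n : ℕ) (f g : UpperHalfPlane → ℂ) (X : ℕ → ℕ → UpperHalfPlane → ℂ)
    (hX : NonHolModular.IsPrimitiveFamily n f g X) (lam : ℕ → ℂ) :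
    (NonHolModular.IsWeakHeckeEigenform n f lam ↔
      NonHolModular.IsWeakHeckeEigenform n g (fun m => conj (lam m))) ∧
    ((∀ m : ℕ, 1 ≤ m → (lam m).im = 0) →
      (NonHolModular.IsWeakHeckeEigenform n f lam ↔
        NonHolModular.IsWeakHeckeEigenform n g lam)) ∧
    (NonHolModular.IsWeakHeckeEigenform n f lam →
      ∀ m : ℕ, 1 ≤ m → ∃ ψ φ : UpperHalfPlane → ℂ,
        NonHolModular.IsWeaklyHolomorphic (-n) ψ ∧
        NonHolModular.IsWeaklyHolomorphic (-n) φ ∧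
        (∀ z, NonHolModular.hecke m (n + 2) 0 f z - lam m * f z =
          1 / (n.factorial : ℂ) * NonHolModular.LL z ^ (-(n : ℤ) - 1) *
            NonHolModular.delPow (-n) (n + 1) ψ z) ∧
        (∀ z, NonHolModular.hecke m (n + 2) 0 g z - conj (lam m) * g z =
          1 / (n.factorial : ℂ) * NonHolModular.LL z ^ (-(n : ℤ) - 1) *
            NonHolModular.delPow (-n) (n + 1) φ z) ∧
        ∀ r s : ℕ, r + s = n → ∀ z,
          NonHolModular.hecke m r s (X r s) z - lam m / m * X r s z =
            1 / (m : ℂ) * NonHolModular.LL z ^ (-(n : ℤ)) *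
              (NonHolModular.delPow (-n) r ψ z / (r.factorial : ℂ) +
                NonHolModular.delBarPow (-n) s (NonHolModular.conjFun φ) z /
                  (s.factorial : ℂ))) := by
  have hS := hX.isSmoothFamily
  have hiff : NonHolModular.IsWeakHeckeEigenform n f lam ↔
      NonHolModular.IsWeakHeckeEigenform n g (fun m => conj (lam m)) :=
    -- For the converse, the conjugate family runs from `g` to `f`, and its companion eigenvalues
    -- are conjugated twice.
    ⟨hS.isWeakHeckeEigenform_companion, fun h => by
      simpa using hS.swap.isWeakHeckeEigenform_companion h⟩
  refine ⟨hiff, fun hreal => hiff.trans (NonHolModular.isWeakHeckeEigenform_congr fun m hm =>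
    Complex.conj_eq_iff_im.mpr (hreal m hm)), fun hf m hm => ?_⟩
  obtain ⟨ψ, hψ, h⟩ := (NonHolModular.exists_normalizedDeriv_iff n _).mp (hf.2 m hm)
  obtain ⟨φ, hφ, h', hXeq⟩ := hS.exists_companion hm (lam m) hψ h
  exact ⟨ψ, φ, hψ, hφ, h, h', hXeq⟩
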